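/- Setting. Fix a prompt $s_0$, a horizon $T\ge 1$, discrete state spaces $\mathcal S_1,\dots,\mathcal S_T$ with prefix spaces $\mathcal S_{1:t}=\mathcal S_{1:t-1}\times\mathcal S_t$, an autoregressive base model $\pi_{\rm ref}(s_t\mid s_0,s_{1:t-1})$ and a positive reward model $\hat V(s_0,s_{1:t})$. The target is $\tilde\pi_T(s_{1:T}\mid s_0)\propto\pi_{\rm ref}(s_{1:T}\mid s_0)\,\hat V(s_0,s_{1:T})$. Assume, for some $L>0$ and $\varepsilon\ge 0$, (ratio bound) for all $1\le t\le T$ and $s_{1:t}$, $\max\Big\{\frac{\hat V(s_0,s_{1:t-1})}{\hat V(s_0,s_{1:t})},\frac{\hat V(s_0,s_{1:t})}{\hat V(s_0,s_{1:t-1})}\Big\}\le L$; (Bellman error bound) for all $0\le t\le T-1$ and $s_{1:t}$, with $Z(s_{1:t})=\mathbb E_{s_{t+1}\sim\pi_{\rm ref}(\cdot\mid s_0,s_{1:t})}[\hat V(s_0,s_{1:t+1})]$, $\max\Big\{\frac{\hat V(s_0,s_{1:t})}{Z(s_{1:t})},\frac{Z(s_{1:t})}{\hat V(s_0,s_{1:t})}\Big\}\le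 1+\varepsilon$. Algorithm. Given a pool size $M\ge1$ and a number of iterations $H\ge1$: in each iteration $h=1,\dots,H$ build a proposal, starting from $s_{1:0}=\varnothing$, $w=1$: for $t=1,\dots,T$ draw $s_t^{(1)},\dots,s_t^{(M)}$ i.i.d. from $\pi_{\rm ref}(\cdot\mid s_0,s_{1:t-1})$, put $v_t^{(j)}=\hat V(s_0,(s_{1:t-1},s_t^{(j)}))$ and $\bar Z_t=\frac1M\sum_j v_t^{(j)}$, draw $A_t$ with $\mathbb P(A_t=j)\propto v_t^{(j)}$, set $s_t=s_t^{(A_t)}$ and multiply $w$ by $\hat V(s_0,s_{1:t})/\bar Z_t$. For $h=1$ set $(s^{\rm acc}_{1:T},w^{\rm acc})=(s_{1:T},w)$; for $h\ge2$ do so with probability $1\wedge\frac{w^{\rm acc}\hat V(s_0,s_{1:T})}{w\,\hat V(s_0,s^{\rm acc}_{1:T})}$, and otherwise keep $(s^{\rm acc}_{1:T},w^{\rm acc})$. Output $s^{\rm acc}_{1:T}$. Running time counts draws from $\pi_{\rm ref}$, evaluations of $\hat V$, arithmetic operations and comparisons, and coin flips, each at unit cost. Theorem. For all $\kappa,K>0$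 there are a constant $C=C(\kappa,K)$ and choices of $M$ and $H$ as functions of $(T,L,\delta,\delta_{\rm TV})$ (given $\kappa,K$) such that, whenever $\varepsilon\le\kappa/T$, $\delta,\delta_{\rm TV}\in(0,1)$ and $\delta\le K\delta_{\rm TV}$, every run of the algorithm takes time at most $$C\,L\,T^3\,\log(2T)\,\log(2/\delta)\,\log(2/\delta_{\rm TV})=\tilde O\big(LT^3\log(\delta^{-1})\log(\delta_{\rm TV}^{-1})\big),$$ and there is an event $\mathcal E$ of the run with $\mathbb P(\mathcal E)\ge1-\delta$ such that the law $\hat\pi_T|_{\mathcal E}$ of the output conditioned on $\mathcal E$ satisfies $\|\tilde\pi_T-\hat\pi_T|_{\mathcal E}\|_{\rm TV}\le\delta_{\rm TV}$, where $\|\mu-\nu\|_{\rm TV}=\sup_A|\mu(A)-\nu(A)|$. -/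

import Mathlib

open scoped NNReal ENNReal

universe u v

noncomputable section

/-! ### Randomised programs with a step counter -/

/-- A randomised program returning a value of type `α`: a joint law of the returned value and
of the number of elementary operations spent. The operations are those of a real-number machine
with oracles: one draw from the base model, one evaluation of the reward model, one arithmetic
operation or comparison, one biased coin flip. -/
abbrev Prog (α : Type u) : Type u := PMF (α × ℕ)

namespace Prog

/-- Return a value at no cost. -/
def ret {α : Type u} (a : α) : Prog α := PMF.pure (a, 0)

/-- Sequential composition: the costs add up. -/
def bind {α : Type u} {β : Type v} (x : Prog α) (f : α → Prog β) : Prog β :=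
  PMF.bind x fun a => PMF.map (fun b : β × ℕ => (b.1, a.2 + b.2)) (f a.1)

/-- Draw from a distribution at cost `n`. -/
def draw {α : Type u} (p : PMF α) (n : ℕ) : Prog α := PMF.map (fun a => (a, n)) p

/-- Pay for `n` elementary operations. -/
def tick (n : ℕ) : Prog Unit := PMF.pure ((), n)

/-- The law of the returned value. -/
def law {α : Type u} (x : Prog α) : PMF α := PMF.map Prod.fst x

/-- Every run of the program spends at most `B` operations. -/
def RunsInTime {α : Type u} (x : Prog α) (B : ℝ) : Prop :=
  ∀ r ∈ PMF.support x, (r.2 : ℝ) ≤ B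

/-- `n` independent draws from `p`, each at unit cost. -/
def drawPool {α : Type u} (p : PMF α) : (n : ℕ) → Prog (Fin n → α)
  | 0 => ret Fin.elim0
  | n + 1 => (draw p 1).bind fun a => (drawPool p n).bind fun c => ret (Fin.cons a c)

end Prog

/-- Total variation distance `sup_A |p(A) - q(A)|`. -/
def tvDist {α : Type u} (p q : PMF α) : ℝ :=
  ⨆ A : Set α, |(p.toOuterMeasure A).toReal - (q.toOuterMeasure A).toReal|

/-- The categorical distribution on `Fin M` with probabilities `v j / ∑ ℓ, v ℓ`. -/
def categorical (M : ℕ+) (v : Fin M → ℝ≥0) (hv : ∀ j, 0 < v j) : PMF (Fin M) :=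
  PMF.normalize (fun j => (v j : ℝ≥0∞))
    (fun h => (hv 0).ne' (by simpa using ENNReal.tsum_eq_zero.1 h 0))
    (by rw [tsum_fintype]; exact ENNReal.sum_ne_top.2 fun _ _ => ENNReal.coe_ne_top)

/-! ### Reasoning models -/

/-- Prefixes `s_{1:t}`: `S_{1:0} = {∅}` and `S_{1:t+1} = S_{1:t} × S_{t+1}`. The space `S 0` is
the space of prompts. -/
def Prefix (S : ℕ → Type u) : ℕ → Type u
  | 0 => PUnit
  | t + 1 => Prefix S t × S (t + 1)

/-- An autoregressive base model on the state spaces `S 1, S 2, …` and a positive reward model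
on prefixes, both given the prompt. `piRef t s₀ s` is the law of `s_{t+1}` given the prompt `s₀` and the
prefix `s = s_{1:t}`; `V t s₀ s` is the reward of the prefix `s = s_{1:t}` (the terminal utility
is the reward at the horizon). -/
structure ReasoningModel (S : ℕ → Type u) where
  piRef : (t : ℕ) → S 0 → Prefix S t → PMF (S (t + 1))
  V : (t : ℕ) → S 0 → Prefix S t → ℝ≥0
  V_pos : ∀ t s₀ s, 0 < V t s₀ s

namespace ReasoningModel

variable {S : ℕ → Type u}

/-- The law of `s_{1:t}` under the base model. -/
def refLaw (m : ReasoningModel S) (s₀ : S 0) : (t : ℕ) → PMF (Prefix S t)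
  | 0 => PMF.pure PUnit.unit
  | t + 1 => (m.refLaw s₀ t).bind fun s => (m.piRef t s₀ s).map fun a => (s, a)

/-- One-step ratio bound on the reward model up to the horizon `T`. -/
def RatioBound (m : ReasoningModel S) (s₀ : S 0) (T : ℕ) (L : ℝ) : Prop :=
  ∀ t < T, ∀ (s : Prefix S t) (a : S (t + 1)),
    (m.V t s₀ s : ℝ) / m.V (t + 1) s₀ (s, a) ≤ L ∧
    (m.V (t + 1) s₀ (s, a) : ℝ) / m.V t s₀ s ≤ L

/-- The conditional mean `E_{s_{t+1} ∼ π_ref(· | s₀, s_{1:t})} V(s₀, s_{1:t+1})`. -/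
def nextMean (m : ReasoningModel S) (s₀ : S 0) (t : ℕ) (s : Prefix S t) : ℝ≥0∞ :=
  ∑' a, m.piRef t s₀ s a * m.V (t + 1) s₀ (s, a)

/-- Uniform bound on the local Bellman error up to the horizon `T`. -/
def BellmanBound (m : ReasoningModel S) (s₀ : S 0) (T : ℕ) (ε : ℝ) : Prop :=
  ∀ t < T, ∀ s : Prefix S t,
    (m.V t s₀ s : ℝ≥0∞) / m.nextMean s₀ t s ≤ ENNReal.ofReal (1 + ε) ∧
    m.nextMean s₀ t s / (m.V t s₀ s : ℝ≥0∞) ≤ ENNReal.ofReal (1 + ε)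

theorem RatioBound.V_le {m : ReasoningModel S} {s₀ : S 0} {T : ℕ} {L : ℝ}
    (h : m.RatioBound s₀ T L) :
    ∀ t ≤ T, ∀ s : Prefix S t, m.V t s₀ s ≤ L.toNNReal ^ t * m.V 0 s₀ PUnit.unit
  | 0, _, s => by cases s; simp
  | t + 1, ht, (s, a) => by
    have h1 := (h t ht s a).2
    rw [div_le_iff₀ (by exact_mod_cast m.V_pos t s₀ s)] at h1
    have h2 : m.V (t + 1) s₀ (s, a) ≤ L.toNNReal * m.V t s₀ s := by
      rw [← NNReal.coe_le_coe]
      push_cast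
      exact h1.trans (mul_le_mul_of_nonneg_right (Real.le_coe_toNNReal L) (by positivity))
    calc _ ≤ _ := h2
      _ ≤ L.toNNReal * (L.toNNReal ^ t * m.V 0 s₀ PUnit.unit) := by
        gcongr
        exact h.V_le t (by omega) s
      _ = _ := by ring

/-- The reward-tilted target law `∝ π_ref(s_{1:T} | s₀) V(s₀, s_{1:T})` of trajectories. -/
def target (m : ReasoningModel S) (s₀ : S 0) (T : ℕ) {L : ℝ} (h : m.RatioBound s₀ T L) :
    PMF (Prefix S T) :=
  PMF.normalize (fun s => m.refLaw s₀ T s * (m.V T s₀ s : ℝ≥0∞))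
    (fun h0 => by
      obtain ⟨s, hs⟩ := (m.refLaw s₀ T).support_nonempty
      have h1 := ENNReal.tsum_eq_zero.1 h0 s
      rcases mul_eq_zero.1 h1 with h2 | h2
      · exact hs h2
      · exact (m.V_pos T s₀ s).ne' (by simpa using h2))
    (ne_top_of_le_ne_top
      (b := ∑' s, m.refLaw s₀ T s * ((L.toNNReal ^ T * m.V 0 s₀ PUnit.unit : ℝ≥0) : ℝ≥0∞))
      (by rw [ENNReal.tsum_mul_right, PMF.tsum_coe, one_mul]; exact ENNReal.coe_ne_top)
      (ENNReal.tsum_le_tsum fun s =>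
        mul_le_mul_right (ENNReal.coe_le_coe.2 (h.V_le T le_rfl s)) _))

/-! ### Single-particle guided SMC with pools of size `M` and Metropolis–Hastings correction -/

/-- Record of the pools and selected indices of the first `t` steps of a proposal. -/
def Pools (S : ℕ → Type u) (M : ℕ+) : ℕ → Type u
  | 0 => PUnit
  | t + 1 => Pools S M t × ((Fin M → S (t + 1)) × Fin M)

/-- State of the proposal loop after `t` steps: the record of all random draws, the current
prefix `s_{1:t}` and the weight `w`. The record is not used by the algorithm; it is kept to
speak of events of the run. -/
structure Proposal (S : ℕ → Type u) (M : ℕ+) (t : ℕ) where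
  pools : Pools S M t
  path : Prefix S t
  weight : ℝ≥0

/-- One step of the proposal loop. -/
def proposalStep (m : ReasoningModel S) (s₀ : S 0) (M : ℕ+) (t : ℕ) (x : Proposal S M t) :
    Prog (Proposal S M (t + 1)) :=
  -- `M` draws from the base model
  (Prog.drawPool (m.piRef t s₀ x.path) M).bind fun c =>
  -- `M` evaluations of the reward model
  (Prog.tick M).bind fun _ =>
  let v : Fin M → ℝ≥0 := fun j => m.V (t + 1) s₀ (x.path, c j)
  -- `M - 1` additions and one division
  (Prog.tick M).bind fun _ =>
  let Zbar : ℝ≥0 := (∑ j, v j) / (M : ℕ)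
  -- selection of an index by inversion: a uniform draw, `M` partial sums and `M` comparisons
  (Prog.draw (categorical M v fun _ => m.V_pos _ _ _) (2 * M + 1)).bind fun A =>
  -- appending the selected state, one division and one multiplication
  (Prog.tick 3).bind fun _ =>
  Prog.ret ⟨(x.pools, (c, A)), (x.path, c A), x.weight * (v A / Zbar)⟩

/-- The first `t` steps of the proposal loop, started from the empty prefix with weight `1`. -/
def proposal (m : ReasoningModel S) (s₀ : S 0) (M : ℕ+) : (t : ℕ) → Prog (Proposal S M t)
  | 0 => (Prog.tick 1).bind fun _ => Prog.ret ⟨PUnit.unit, PUnit.unit, 1⟩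
  | t + 1 => (m.proposal s₀ M t).bind fun x => m.proposalStep s₀ M t x

/-- State of the outer loop: the record of all proposals with the decisions taken (latest
first), and the accepted trajectory with its weight. -/
structure Run (S : ℕ → Type u) (M : ℕ+) (T : ℕ) where
  history : List (Pools S M T × Bool)
  path : Prefix S T
  weight : ℝ≥0

/-- Probability of accepting the proposal `y` when the accepted trajectory is that of `x`. -/
def acceptProb (m : ReasoningModel S) (s₀ : S 0) {M : ℕ+} {T : ℕ} (x : Run S M T)
    (y : Proposal S M T) : ℝ≥0 :=
  min 1 ((x.weight * m.V T s₀ y.path) / (y.weight * m.V T s₀ x.path))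

/-- One Metropolis–Hastings iteration (`h ≥ 2`). The test `α < acceptProb` with a uniform
`α ∈ [0,1]` is a coin with bias `acceptProb`. -/
def mhStep (m : ReasoningModel S) (s₀ : S 0) (M : ℕ+) (T : ℕ) (x : Run S M T) :
    Prog (Run S M T) :=
  (m.proposal s₀ M T).bind fun y =>
  -- two evaluations of the reward model, two multiplications, one division, one minimum
  (Prog.tick 6).bind fun _ =>
  (Prog.draw (PMF.bernoulli (m.acceptProb s₀ x y) (min_le_left _ _)) 2).bind fun accept =>
  (Prog.tick 2).bind fun _ =>
  Prog.ret
    (if accept then ⟨(y.pools, true) :: x.history, y.path, y.weight⟩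
      else ⟨(y.pools, false) :: x.history, x.path, x.weight⟩)

/-- The iteration `h = 1`, whose proposal is accepted, followed by `k` Metropolis–Hastings
iterations. -/
def mhLoop (m : ReasoningModel S) (s₀ : S 0) (M : ℕ+) (T : ℕ) : ℕ → Prog (Run S M T)
  | 0 => (m.proposal s₀ M T).bind fun y =>
      (Prog.tick 2).bind fun _ => Prog.ret ⟨[(y.pools, true)], y.path, y.weight⟩
  | k + 1 => (m.mhLoop s₀ M T k).bind fun x => m.mhStep s₀ M T x

/-- The whole algorithm with horizon `T`, pool size `M` and `H ≥ 1` iterations. Its output is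
the field `path` of the final state. -/
def resamplingMH (m : ReasoningModel S) (s₀ : S 0) (T : ℕ) (M H : ℕ+) : Prog (Run S M T) :=
  m.mhLoop s₀ M T (H - 1 : ℕ)

/-- The law of the output of the algorithm conditioned on an event `E` of the run. -/
def outputGiven (m : ReasoningModel S) (s₀ : S 0) (T : ℕ) (M H : ℕ+) (E : Set (Run S M T))
    (hE : ∃ r ∈ E, r ∈ (m.resamplingMH s₀ T M H).law.support) : PMF (Prefix S T) :=
  ((m.resamplingMH s₀ T M H).law.filter E hE).map Run.path

end ReasoningModel

end

/-! The selected path and its weight are functions of the record of pools, so the algorithm is an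
independent Metropolis–Hastings chain on records. The importance ratio `ω = V / w` of a record does
not depend on the selected indices: it is the initial reward times the product over steps of the
pool averages of the one-step reward ratios (`poolsRatio_succ`). Since `1 / w` undoes the weighted
selection, tilting the law of records by `ω` gives the target as law of the path
(`expect_poolsRatio`).

The pool averages concentrate. With `M ≥ k T L` the exponential moment bound gives `E ω ^ k ≤ exp (k
(2κ + 1)) V₀ ^ k`, where `V₀` is the initial reward, so by Markov's inequality `ω` exceeds `B = exp
(2κ + 2) V₀` with probability at most `exp (-k)`. The event is that all `H` proposals satisfy `ω ≤
B`. Rejected proposals are included, so conditioning on it merely replaces the proposal law by its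
restriction to good records.

On good records every acceptance probability is at least `ω(y) / B`, a minorisation of the
transition by the stationary law. The Bellman bound keeps the normalising constant above `exp (-κ)
V₀`, so the minorisation constant depends on `κ` alone and `H` of order `log (2 / δTV)` suffices
(`stat_le_iter`). The output law and the target both dominate a multiple of the stationary law on
good records, which bounds their distance (`tvDist_le_of_dominate`). -/

noncomputable section

/-! ### Expectations under a probability mass function -/

/-- The expectation of a nonnegative function. -/
def PMF.expect {α : Type u} (p : PMF α) (f : α → ℝ≥0∞) : ℝ≥0∞ := ∑' a, p a * f a

namespace PMF

variable {α : Type u} {β : Type v}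

theorem expect_pure (a : α) (f : α → ℝ≥0∞) : (PMF.pure a).expect f = f a := by
  classical
  rw [expect, tsum_eq_single a]
  · simp
  · intro b hb
    simp [hb]

theorem expect_bind (p : PMF α) (k : α → PMF β) (f : β → ℝ≥0∞) :
    (p.bind k).expect f = p.expect fun a => (k a).expect f := by
  simp only [expect, bind_apply, ← ENNReal.tsum_mul_right, ← ENNReal.tsum_mul_left]
  rw [ENNReal.tsum_comm]
  simp only [mul_assoc]

theorem expect_map (p : PMF α) (g : α → β) (f : β → ℝ≥0∞) :
    (p.map g).expect f = p.expect fun a => f (g a) := by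
  rw [← bind_pure_comp, expect_bind]
  simp [expect_pure]

theorem expect_mono (p : PMF α) {f g : α → ℝ≥0∞} (h : ∀ a, f a ≤ g a) :
    p.expect f ≤ p.expect g :=
  ENNReal.tsum_le_tsum fun a => mul_le_mul_right (h a) _

theorem expect_add (p : PMF α) (f g : α → ℝ≥0∞) :
    (p.expect fun a => f a + g a) = p.expect f + p.expect g := by
  simp only [expect, mul_add, ENNReal.tsum_add]

theorem expect_mul_left (p : PMF α) (c : ℝ≥0∞) (f : α → ℝ≥0∞) :
    (p.expect fun a => c * f a) = c * p.expect f := by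
  simp only [expect, ← ENNReal.tsum_mul_left, mul_left_comm]

theorem expect_mul_right (p : PMF α) (c : ℝ≥0∞) (f : α → ℝ≥0∞) :
    (p.expect fun a => f a * c) = p.expect f * c := by
  simp only [mul_comm _ c, expect_mul_left]

theorem expect_const (p : PMF α) (c : ℝ≥0∞) : (p.expect fun _ => c) = c := by
  simp only [expect, ENNReal.tsum_mul_right, tsum_coe, one_mul]

theorem expect_comm (p : PMF α) (q : PMF β) (f : α → β → ℝ≥0∞) :
    (p.expect fun a => q.expect (f a)) = q.expect fun b => p.expect fun a => f a b := by
  simp only [expect, ← ENNReal.tsum_mul_left]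
  rw [ENNReal.tsum_comm]
  simp only [mul_left_comm]

theorem toOuterMeasure_eq_expect (p : PMF α) (A : Set α) :
    p.toOuterMeasure A = p.expect (A.indicator 1) := by
  rw [toOuterMeasure_apply, expect]
  congr 1 with a
  by_cases h : a ∈ A <;> simp [h]

theorem expect_fintype [Fintype α] (p : PMF α) (f : α → ℝ≥0∞) :
    p.expect f = ∑ a, p a * f a := tsum_fintype _

theorem expect_bernoulli (a : ℝ≥0) (h : a ≤ 1) (f : Bool → ℝ≥0∞) :
    (PMF.bernoulli a h).expect f = a * f true + (1 - a : ℝ≥0) * f false := by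
  rw [expect_fintype, Fintype.sum_bool]
  simp [bernoulli_apply]

end PMF

/-! ### Laws and costs of programs -/

namespace Prog

variable {α : Type u} {β : Type v}

@[simp] theorem law_ret (a : α) : (ret a).law = PMF.pure a := by
  simp [law, ret, PMF.pure_map]

@[simp] theorem law_tick (n : ℕ) : (tick n).law = PMF.pure () := by
  simp [law, tick, PMF.pure_map]

@[simp] theorem law_draw (p : PMF α) (n : ℕ) : (draw p n).law = p := by
  rw [law, draw, PMF.map_comp]
  exact PMF.map_id p

@[simp] theorem law_bind (x : Prog α) (f : α → Prog β) :
    (x.bind f).law = x.law.bind fun a => (f a).law := by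
  simp only [law, bind, PMF.map_bind, PMF.map_comp, PMF.bind_map]
  rfl

/-- Every run of the program spends at most `n` operations. -/
def CostLE (x : Prog α) (n : ℕ) : Prop := ∀ r ∈ PMF.support x, r.2 ≤ n

theorem costLE_ret (a : α) : (ret a).CostLE 0 := by
  intro r hr
  simp only [ret, PMF.support_pure, Set.mem_singleton_iff] at hr
  simp [hr]

theorem costLE_tick (n : ℕ) : (tick n).CostLE n := by
  intro r hr
  simp only [tick, PMF.support_pure, Set.mem_singleton_iff] at hr
  simp [hr]

theorem costLE_draw (p : PMF α) (n : ℕ) : (draw p n).CostLE n := by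
  intro r hr
  simp only [draw, PMF.support_map] at hr
  obtain ⟨a, -, rfl⟩ := hr
  exact le_rfl

theorem CostLE.bind {x : Prog α} {f : α → Prog β} {a b : ℕ} (hx : x.CostLE a)
    (hf : ∀ y, (f y).CostLE b) : (x.bind f).CostLE (a + b) := by
  intro r hr
  simp only [Prog.bind, PMF.mem_support_bind_iff, PMF.support_map] at hr
  obtain ⟨y, hy, z, hz, rfl⟩ := hr
  exact Nat.add_le_add (hx y hy) (hf _ z hz)

theorem CostLE.mono {x : Prog α} {a b : ℕ} (hx : x.CostLE a) (h : a ≤ b) : x.CostLE b :=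
  fun r hr => (hx r hr).trans h

theorem costLE_drawPool (p : PMF α) : ∀ n, (drawPool p n).CostLE n
  | 0 => costLE_ret _
  | n + 1 => ((costLE_draw p 1).bind fun _ =>
      (costLE_drawPool p n).bind fun _ => costLE_ret _).mono (by omega)

/-! ### Pools of independent draws -/

theorem expect_drawPool_succ (p : PMF α) (n : ℕ) (f : (Fin (n + 1) → α) → ℝ≥0∞) :
    (drawPool p (n + 1)).law.expect f =
      p.expect fun a => (drawPool p n).law.expect fun c => f (Fin.cons a c) := by
  simp [drawPool, PMF.expect_bind, PMF.expect_pure]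

theorem expect_drawPool_prod (p : PMF α) (g : α → ℝ≥0∞) :
    ∀ n, ((drawPool p n).law.expect fun c => ∏ j, g (c j)) = p.expect g ^ n
  | 0 => by simp [PMF.expect_const]
  | n + 1 => by
    simp only [expect_drawPool_succ, Fin.prod_univ_succ, Fin.cons_zero, Fin.cons_succ,
      PMF.expect_mul_left, expect_drawPool_prod p g n, PMF.expect_mul_right, pow_succ']

theorem expect_drawPool_sum (p : PMF α) (g : α → ℝ≥0∞) :
    ∀ n : ℕ, ((drawPool p n).law.expect fun c => ∑ j, g (c j)) = n * p.expect g
  | 0 => by simp [PMF.expect_const]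
  | n + 1 => by
    simp only [expect_drawPool_succ, Fin.sum_univ_succ, Fin.cons_zero, Fin.cons_succ,
      PMF.expect_add, expect_drawPool_sum p g n, PMF.expect_const]
    push_cast
    ring

/-- Exponential moment bound for the empirical mean of bounded nonnegative variables, in the
form of a bound on its `k`-th moment. -/
theorem expect_drawPool_mean_pow_le (p : PMF α) (x : α → ℝ≥0) {L η μ : ℝ} {n k : ℕ}
    (hn : 0 < n) (hη : 0 ≤ η) (hη1 : η ≤ 1) (hμ : 0 ≤ μ) (hk : k * L ≤ n * η)
    (hx : ∀ a, (x a : ℝ) ≤ L) (hE : p.expect (fun a => x a) ≤ ENNReal.ofReal μ) :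
    ((drawPool p n).law.expect fun c => (((∑ j, x (c j)) / n : ℝ≥0) : ℝ≥0∞) ^ k) ≤
      ENNReal.ofReal (Real.exp (k * ((1 + η) * μ - 1))) := by
  have hn' : (0 : ℝ) < n := by exact_mod_cast hn
  -- With `y = k x / n ≤ η ≤ 1`, one has `exp y ≤ 1 + y + y² ≤ 1 + (1 + η) y`: the slack `η` pays
  -- for the quadratic term, and `k L ≤ n η` is what forces `y ≤ η`.
  set θ : ℝ := (1 + η) * k / n with hθ
  have hθ0 : 0 ≤ θ := by positivity
  have h1 : ∀ a, Real.exp (k * x a / n) ≤ 1 + θ * x a := by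
    intro a
    set y : ℝ := k * x a / n with hy
    have hy0 : 0 ≤ y := by positivity
    have hyη : y ≤ η := by
      rw [hy, div_le_iff₀ hn']
      calc _ ≤ k * L := by gcongr; exact hx a
        _ ≤ _ := by linarith
    have h2 := Real.abs_exp_sub_one_sub_id_le (x := y) (by rw [abs_of_nonneg hy0]; linarith)
    have h3 : θ * x a = (1 + η) * y := by rw [hθ, hy]; ring
    rw [h3]
    nlinarith [abs_le.1 h2]
  have h2 : ∀ c : Fin n → α, (((∑ j, x (c j)) / n : ℝ≥0) : ℝ≥0∞) ^ k ≤
      ENNReal.ofReal (Real.exp (-k)) * ∏ j, (1 + ENNReal.ofReal θ * x (c j)) := by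
    intro c
    have e1 : ∏ j, (1 + ENNReal.ofReal θ * (x (c j) : ℝ≥0∞)) =
        ENNReal.ofReal (∏ j, (1 + θ * x (c j))) := by
      rw [ENNReal.ofReal_prod_of_nonneg fun j _ => by positivity]
      refine Finset.prod_congr rfl fun j _ => ?_
      rw [ENNReal.ofReal_add zero_le_one (by positivity), ENNReal.ofReal_mul hθ0]
      simp
    rw [e1, ← ENNReal.ofReal_mul (Real.exp_pos _).le, ← ENNReal.ofReal_coe_nnreal,
      ← ENNReal.ofReal_pow (by positivity)]
    apply ENNReal.ofReal_le_ofReal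
    push_cast
    set X : ℝ := (∑ j, (x (c j) : ℝ)) / n with hX
    -- `X ≤ exp (X - 1)` turns the power of a mean into a product over the independent draws.
    calc X ^ k ≤ Real.exp (X - 1) ^ k := by
          gcongr
          linarith [Real.add_one_le_exp (X - 1)]
      _ = Real.exp (-k) * ∏ j, Real.exp (k * x (c j) / n) := by
          rw [← Real.exp_sum, ← Real.exp_add, ← Real.exp_nat_mul, ← Finset.sum_div,
            ← Finset.mul_sum, hX]
          congr 1
          ring
      _ ≤ _ := by
          gcongr with j
          exact h1 _
  have h3 : (p.expect fun a => 1 + ENNReal.ofReal θ * x a) ≤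
      ENNReal.ofReal (Real.exp (θ * μ)) := by
    rw [PMF.expect_add, PMF.expect_const, PMF.expect_mul_left]
    calc _ ≤ 1 + ENNReal.ofReal θ * ENNReal.ofReal μ := by gcongr
      _ = ENNReal.ofReal (1 + θ * μ) := by
          rw [← ENNReal.ofReal_mul hθ0, ENNReal.ofReal_add zero_le_one (by positivity)]
          simp
      _ ≤ _ := ENNReal.ofReal_le_ofReal (by linarith [Real.add_one_le_exp (θ * μ)])
  calc _ ≤ _ := PMF.expect_mono _ h2
    _ = ENNReal.ofReal (Real.exp (-k)) * (p.expect fun a => 1 + ENNReal.ofReal θ * x a) ^ n := by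
        rw [PMF.expect_mul_left,
          expect_drawPool_prod p (fun a => 1 + ENNReal.ofReal θ * (x a : ℝ≥0∞))]
    _ ≤ ENNReal.ofReal (Real.exp (-k)) * ENNReal.ofReal (Real.exp (θ * μ)) ^ n := by gcongr
    _ = _ := by
        rw [← ENNReal.ofReal_pow (Real.exp_pos _).le, ← ENNReal.ofReal_mul (Real.exp_pos _).le,
          ← Real.exp_nat_mul, ← Real.exp_add]
        congr 2
        rw [hθ]
        field_simp
        ring

end Prog

/-! ### Independent Metropolis–Hastings with proposals restricted to a good set -/

namespace IndepMH

variable {Y : Type u}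

/-- Acceptance probability for importance ratios `a` (current) and `b` (proposed). -/
def accept (a b : ℝ≥0) : ℝ≥0 := min 1 (b / a)

theorem accept_le_one (a b : ℝ≥0) : accept a b ≤ 1 := min_le_left _ _

/-- The symmetry of the right-hand side is detailed balance. -/
theorem mul_accept (a b : ℝ≥0) : a * accept a b = min a b := by
  rcases eq_or_ne a 0 with rfl | h
  · simp
  · rw [accept, mul_min, mul_one, mul_div_cancel₀ _ h]

/-- The transition operator, with proposals outside `G` discarded. -/
def step (Q : PMF Y) (G : Set Y) (ω : Y → ℝ≥0) (φ : Y → ℝ≥0∞) (x : Y) : ℝ≥0∞ :=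
  Q.expect fun y => G.indicator 1 y *
    (accept (ω x) (ω y) * φ y + (1 - accept (ω x) (ω y) : ℝ≥0) * φ x)

/-- Expectation of `φ` at the current state after `k` transitions from a proposal, on the event
that all proposals lie in `G`. -/
def iter (Q : PMF Y) (G : Set Y) (ω : Y → ℝ≥0) : ℕ → (Y → ℝ≥0∞) → ℝ≥0∞
  | 0, φ => Q.expect fun y => G.indicator 1 y * φ y
  | k + 1, φ => iter Q G ω k (step Q G ω φ)

/-- Integration against the unnormalised stationary measure. -/
def stat (Q : PMF Y) (G : Set Y) (ω : Y → ℝ≥0) (φ : Y → ℝ≥0∞) : ℝ≥0∞ :=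
  Q.expect fun y => G.indicator 1 y * ω y * φ y

variable {Q : PMF Y} {G : Set Y} {ω : Y → ℝ≥0}

theorem accept_add (a b : ℝ≥0) (c : ℝ≥0∞) :
    accept a b * c + (1 - accept a b : ℝ≥0) * c = c := by
  rw [← add_mul, ← ENNReal.coe_add, add_tsub_cancel_of_le (accept_le_one a b)]
  simp

theorem step_mono {φ ψ : Y → ℝ≥0∞} (h : ∀ y ∈ G, φ y ≤ ψ y) {x : Y} (hx : x ∈ G) :
    step Q G ω φ x ≤ step Q G ω ψ x := by
  refine PMF.expect_mono _ fun y => ?_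
  by_cases hy : y ∈ G
  · have h1 := h y hy
    have h2 := h x hx
    gcongr
  · simp [hy]

theorem iter_mono : ∀ (k : ℕ) {φ ψ : Y → ℝ≥0∞}, (∀ y ∈ G, φ y ≤ ψ y) →
    iter Q G ω k φ ≤ iter Q G ω k ψ
  | 0, φ, ψ, h => PMF.expect_mono _ fun y => by
      by_cases hy : y ∈ G
      · have h1 := h y hy
        gcongr
      · simp [hy]
  | k + 1, _, _, h => iter_mono k fun _ hx => step_mono h hx

theorem iter_congr (k : ℕ) {φ ψ : Y → ℝ≥0∞} (h : ∀ y ∈ G, φ y = ψ y) :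
    iter Q G ω k φ = iter Q G ω k ψ :=
  le_antisymm (iter_mono k fun y hy => (h y hy).le) (iter_mono k fun y hy => (h y hy).ge)

theorem step_add (φ ψ : Y → ℝ≥0∞) :
    step Q G ω (fun y => φ y + ψ y) = fun x => step Q G ω φ x + step Q G ω ψ x := by
  funext x
  simp only [step]
  rw [← PMF.expect_add]
  congr 1 with y
  ring

theorem iter_add : ∀ (k : ℕ) (φ ψ : Y → ℝ≥0∞),
    iter Q G ω k (fun y => φ y + ψ y) = iter Q G ω k φ + iter Q G ω k ψ
  | 0, φ, ψ => by simp only [iter, mul_add, PMF.expect_add]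
  | k + 1, φ, ψ => by simp only [iter, step_add, iter_add k]

/-- Discarding depends on the proposal only, so each transition loses the same fraction of mass
whatever the current state. Hence the good event has probability a pure power of the mass of `G`. -/
theorem step_const (c : ℝ≥0∞) :
    step Q G ω (fun _ => c) = fun _ => Q.toOuterMeasure G * c := by
  funext x
  simp only [step, accept_add, PMF.expect_mul_right, PMF.toOuterMeasure_eq_expect]

theorem iter_const : ∀ (k : ℕ) (c : ℝ≥0∞),
    iter Q G ω k (fun _ => c) = Q.toOuterMeasure G ^ (k + 1) * c
  | 0, c => by simp only [iter, PMF.expect_mul_right, PMF.toOuterMeasure_eq_expect, zero_add,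
      pow_one]
  | k + 1, c => by rw [iter, step_const, iter_const k]; ring

theorem stat_add (φ ψ : Y → ℝ≥0∞) :
    stat Q G ω (fun y => φ y + ψ y) = stat Q G ω φ + stat Q G ω ψ := by
  simp only [stat, mul_add, PMF.expect_add]

theorem stat_const (c : ℝ≥0∞) : stat Q G ω (fun _ => c) = stat Q G ω 1 * c := by
  simp only [stat, PMF.expect_mul_right, Pi.one_apply, mul_one]

theorem stat_mono {φ ψ : Y → ℝ≥0∞} (h : ∀ y ∈ G, φ y ≤ ψ y) :
    stat Q G ω φ ≤ stat Q G ω ψ := by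
  refine PMF.expect_mono _ fun y => ?_
  by_cases hy : y ∈ G
  · have h1 := h y hy
    gcongr
  · simp [hy]

theorem stat_congr {φ ψ : Y → ℝ≥0∞} (h : ∀ y ∈ G, φ y = ψ y) :
    stat Q G ω φ = stat Q G ω ψ :=
  le_antisymm (stat_mono fun y hy => (h y hy).le) (stat_mono fun y hy => (h y hy).ge)

/-- Stationarity, by detailed balance. -/
theorem stat_step (φ : Y → ℝ≥0∞) :
    stat Q G ω (step Q G ω φ) = Q.toOuterMeasure G * stat Q G ω φ := by
  set J : Y → ℝ≥0∞ := G.indicator 1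
  have h1 : stat Q G ω (step Q G ω φ) =
      (Q.expect fun x => Q.expect fun y => J x * J y * (min (ω x) (ω y) : ℝ≥0) * φ y) +
      Q.expect fun x => Q.expect fun y =>
        J x * J y * (ω x * (1 - accept (ω x) (ω y) : ℝ≥0)) * φ x := by
    rw [← PMF.expect_add]
    simp only [stat, step]
    congr 1 with x
    rw [← PMF.expect_add, ← PMF.expect_mul_left]
    congr 1 with y
    rw [← mul_accept, ENNReal.coe_mul]
    ring
  -- Exchange current and proposed state in the accepted part; by symmetry of the minimum it then
  -- recombines with the rejected part.
  rw [h1, PMF.expect_comm, ← PMF.expect_add]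
  simp only [stat, PMF.toOuterMeasure_eq_expect]
  rw [← PMF.expect_mul_left]
  congr 1 with x
  rw [← PMF.expect_add, ← PMF.expect_mul_right]
  congr 1 with y
  rw [min_comm, ← mul_accept, ENNReal.coe_mul]
  conv_rhs => rw [← accept_add (ω x) (ω y) (φ x)]
  ring

/-! ### Minorisation and uniform ergodicity for bounded importance ratios. -/

variable {B : ℝ≥0}

/-- Both entries of the minimum are at least `b / B`, a bound free of the current ratio `a`. -/
theorem div_le_accept {a b : ℝ≥0} (ha : 0 < a) (haB : a ≤ B) (hbB : b ≤ B) :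
    b / B ≤ accept a b := by
  have hB : 0 < B := ha.trans_le haB
  refine le_min ?_ ?_
  · rw [div_le_one hB]; exact hbB
  · gcongr

/-- Minorisation of the transition operator by the stationary measure. -/
theorem stat_div_le_step (hω : ∀ y, 0 < ω y) (hB : ∀ y ∈ G, ω y ≤ B) (φ : Y → ℝ≥0∞) {x : Y}
    (hx : x ∈ G) : stat Q G ω φ * (B⁻¹ : ℝ≥0) ≤ step Q G ω φ x := by
  rw [stat, ← PMF.expect_mul_right]
  refine PMF.expect_mono _ fun y => ?_
  by_cases hy : y ∈ G
  · have h := div_le_accept (hω x) (hB x hx) (hB y hy)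
    simp only [hy, Set.indicator_of_mem, Pi.one_apply, one_mul]
    refine le_trans ?_ le_self_add
    calc _ = ((ω y / B : ℝ≥0) : ℝ≥0∞) * φ y := by
          rw [div_eq_mul_inv, ENNReal.coe_mul]; ring
      _ ≤ _ := by gcongr
  · simp [hy]

/-- The initial proposal satisfies the same minorisation as a transition, whence the exponent `k +
1` after `k` transitions. -/
theorem stat_div_le_init (hB0 : 0 < B) (hB : ∀ y ∈ G, ω y ≤ B) (φ : Y → ℝ≥0∞) :
    stat Q G ω φ * (B⁻¹ : ℝ≥0) ≤ iter Q G ω 0 φ := by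
  rw [stat, ← PMF.expect_mul_right]
  refine PMF.expect_mono _ fun y => ?_
  by_cases hy : y ∈ G
  · simp only [hy, Set.indicator_of_mem, Pi.one_apply, one_mul]
    calc _ = ((ω y / B : ℝ≥0) : ℝ≥0∞) * φ y := by
          rw [div_eq_mul_inv, ENNReal.coe_mul]; ring
      _ ≤ 1 * φ y := by
          gcongr
          exact_mod_cast (div_le_one hB0).2 (hB y hy)
      _ = _ := one_mul _
  · simp [hy]

/-- Uniform ergodicity: after `k` transitions the law of the current state dominates
`1 - (1 - r) ^ (k + 1)` times the stationary law. -/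
theorem stat_le_iter (hω : ∀ y, 0 < ω y) (hB0 : 0 < B) (hB : ∀ y ∈ G, ω y ≤ B) {r s : ℝ≥0}
    (hrs : r + s = 1) (hr : r * B ≤ stat Q G ω 1) (hc : stat Q G ω 1 ≠ ∞) (hr0 : 0 < r) :
    ∀ (k : ℕ) (φ : Y → ℝ≥0∞), stat Q G ω φ ≠ ∞ →
      ((1 - s ^ (k + 1) : ℝ≥0) : ℝ≥0∞) * Q.toOuterMeasure G ^ (k + 1) * stat Q G ω φ ≤
        stat Q G ω 1 * iter Q G ω k φ := by
  set g := Q.toOuterMeasure G with hg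
  set c := stat Q G ω 1 with hcdef
  have hg1 : g ≤ 1 := by
    rw [hg, PMF.toOuterMeasure_eq_expect, ← PMF.expect_const Q 1]
    exact PMF.expect_mono _ fun y => Set.indicator_le_self' (by simp) y
  have hc0 : c ≠ 0 := by
    have : (0 : ℝ≥0∞) < r * B := by exact_mod_cast mul_pos hr0 hB0
    exact (this.trans_le hr).ne'
  have hs1 : s ≤ 1 := hrs ▸ le_add_self
  -- The factor `g ≤ 1` is given away so that the remainder `D` below has stationary integral
  -- exactly `g * s` times that of `φ`.
  have hminor : ∀ z : ℝ≥0∞, g * r * z ≤ c * (z * (B⁻¹ : ℝ≥0)) := by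
    intro z
    calc g * r * z ≤ 1 * r * z := by gcongr
      _ = r * B * (z * (B⁻¹ : ℝ≥0)) := by
          have : (B : ℝ≥0∞) * (B⁻¹ : ℝ≥0) = 1 := by
            rw [← ENNReal.coe_mul, mul_inv_cancel₀ hB0.ne']; simp
          calc _ = r * z * 1 := by ring
            _ = _ := by rw [← this]; ring
      _ ≤ _ := by gcongr
  intro k
  induction k with
  | zero =>
    intro φ _
    have h1 : 1 - s ^ (0 + 1) = r := by rw [zero_add, pow_one, ← hrs, add_tsub_cancel_right]
    rw [h1, zero_add, pow_one]
    calc _ = g * r * stat Q G ω φ := by ring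
      _ ≤ _ := hminor _
      _ ≤ _ := by
        gcongr
        exact stat_div_le_init hB0 hB φ
  | succ k ih =>
    intro φ hφ
    have hgt : g ≠ ∞ := ne_top_of_le_ne_top ENNReal.one_ne_top hg1
    -- Split one transition into the constant `b` guaranteed by minorisation and a remainder.
    -- Stationarity computes the integral of the remainder, to which the induction hypothesis
    -- applies.
    set b : ℝ≥0∞ := g * r * stat Q G ω φ / c with hb
    have hcb : c * b = g * r * stat Q G ω φ := ENNReal.mul_div_cancel hc0 hc
    have hbK : ∀ x ∈ G, b ≤ step Q G ω φ x := by
      intro x hx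
      refine le_trans ?_ (stat_div_le_step hω hB φ hx)
      rw [hb]
      exact ENNReal.div_le_of_le_mul ((hminor _).trans_eq (mul_comm _ _))
    set D : Y → ℝ≥0∞ := fun x => step Q G ω φ x - b with hD
    have hDb : ∀ x ∈ G, step Q G ω φ x = D x + b := fun x hx =>
      (tsub_add_cancel_of_le (hbK x hx)).symm
    have hstat : stat Q G ω D + c * b = g * stat Q G ω φ := by
      rw [← stat_step, stat_congr hDb, stat_add, stat_const]
    have hDs : stat Q G ω D = g * s * stat Q G ω φ := by
      have h2 : g * stat Q G ω φ = g * s * stat Q G ω φ + c * b := by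
        have : (1 : ℝ≥0∞) = s + r := by rw [add_comm]; exact_mod_cast hrs.symm
        rw [hcb]
        calc _ = g * 1 * stat Q G ω φ := by ring
          _ = _ := by rw [this]; ring
      rw [h2] at hstat
      refine (ENNReal.add_left_inj ?_).1 hstat
      rw [hcb]
      exact ENNReal.mul_ne_top (ENNReal.mul_ne_top hgt ENNReal.coe_ne_top) hφ
    have hDt : stat Q G ω D ≠ ∞ := by
      rw [hDs]
      exact ENNReal.mul_ne_top (ENNReal.mul_ne_top hgt ENNReal.coe_ne_top) hφ
    have hα : 1 - s ^ (k + 1 + 1) = (1 - s ^ (k + 1)) * s + r := by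
      have hsk : s ^ (k + 1) ≤ 1 := pow_le_one₀ zero_le hs1
      have hsk2 : s ^ (k + 1 + 1) ≤ 1 := pow_le_one₀ zero_le hs1
      have hrs' : (r : ℝ) + s = 1 := by exact_mod_cast hrs
      rw [← NNReal.coe_inj, NNReal.coe_sub hsk2, NNReal.coe_add, NNReal.coe_mul,
        NNReal.coe_sub hsk]
      push_cast
      rw [pow_succ (s : ℝ) (k + 1)]
      linarith
    rw [iter, iter_congr k hDb, iter_add, iter_const, mul_add]
    calc _ = ((1 - s ^ (k + 1) : ℝ≥0) : ℝ≥0∞) * g ^ (k + 1) * (g * s * stat Q G ω φ) +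
          g ^ (k + 1) * (g * r * stat Q G ω φ) := by
          rw [hα, ENNReal.coe_add, ENNReal.coe_mul]; ring
      _ ≤ c * iter Q G ω k D + c * (g ^ (k + 1) * b) := by
          rw [← hDs, ← hcb]
          exact add_le_add (ih D hDt) (le_of_eq (by ring))

end IndepMH

namespace ReasoningModel

variable {S : ℕ → Type u}

/-! ### The law of the pools of a proposal -/

/-- The prefix selected in a record of pools. -/
def poolsPath (M : ℕ+) : (t : ℕ) → Pools S M t → Prefix S t
  | 0, _ => PUnit.unit
  | t + 1, P => (poolsPath M t P.1, P.2.1 P.2.2)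

/-- The weight of a record of pools. -/
def poolsWeight (m : ReasoningModel S) (s₀ : S 0) (M : ℕ+) : (t : ℕ) → Pools S M t → ℝ≥0
  | 0, _ => 1
  | t + 1, P => m.poolsWeight s₀ M t P.1 * (m.V (t + 1) s₀ (poolsPath M t P.1, P.2.1 P.2.2) /
      ((∑ j, m.V (t + 1) s₀ (poolsPath M t P.1, P.2.1 j)) / (M : ℕ)))

/-- The ratio of terminal reward and weight, an unnormalised importance ratio. -/
def poolsRatio (m : ReasoningModel S) (s₀ : S 0) (M : ℕ+) (t : ℕ) (P : Pools S M t) : ℝ≥0 :=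
  m.V t s₀ (poolsPath M t P) / m.poolsWeight s₀ M t P

/-- The state of the proposal loop determined by a record of pools. -/
def ofPools (m : ReasoningModel S) (s₀ : S 0) (M : ℕ+) (t : ℕ) (P : Pools S M t) :
    Proposal S M t :=
  ⟨P, poolsPath M t P, m.poolsWeight s₀ M t P⟩

/-- The law of the record of pools. -/
def poolsLaw (m : ReasoningModel S) (s₀ : S 0) (M : ℕ+) : (t : ℕ) → PMF (Pools S M t)
  | 0 => PMF.pure PUnit.unit
  | t + 1 => (m.poolsLaw s₀ M t).bind fun P =>
      (Prog.drawPool (m.piRef t s₀ (poolsPath M t P)) M).law.bind fun c =>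
        (categorical M (fun j => m.V (t + 1) s₀ (poolsPath M t P, c j))
          fun _ => m.V_pos _ _ _).map fun A => (P, (c, A))

variable (m : ReasoningModel S) (s₀ : S 0) (M : ℕ+)

/-- Path and weight are determined by the record, so the chain can be studied on records alone. -/
theorem proposal_law : ∀ t, (m.proposal s₀ M t).law = (m.poolsLaw s₀ M t).map (m.ofPools s₀ M t)
  | 0 => by
    simp only [proposal, Prog.law_bind, Prog.law_tick, Prog.law_ret, PMF.pure_bind, poolsLaw]
    exact (PMF.pure_map (m.ofPools s₀ M 0) _).symm
  | t + 1 => by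
    simp only [proposal, Prog.law_bind, proposal_law t, poolsLaw, PMF.map_bind, PMF.bind_map,
      proposalStep, Prog.law_tick, PMF.pure_bind, Prog.law_draw, Prog.law_ret]
    congr 1 with P : 1
    refine congrArg (PMF.bind _) (funext fun c => ?_)
    refine .trans ?_ (PMF.map_comp _ _ _).symm
    rfl

theorem expect_poolsLaw_succ (t : ℕ) (f : Pools S M (t + 1) → ℝ≥0∞) :
    (m.poolsLaw s₀ M (t + 1)).expect f =
      (m.poolsLaw s₀ M t).expect fun P =>
        (Prog.drawPool (m.piRef t s₀ (poolsPath M t P)) M).law.expect fun c =>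
          (categorical M (fun j => m.V (t + 1) s₀ (poolsPath M t P, c j))
            fun _ => m.V_pos _ _ _).expect fun A => f (P, (c, A)) := by
  rw [poolsLaw, PMF.expect_bind]
  congr 1 with P
  rw [PMF.expect_bind]
  congr 1 with c
  exact PMF.expect_map _ _ f

theorem expect_poolsLaw_zero (f : Pools S M 0 → ℝ≥0∞) :
    (m.poolsLaw s₀ M 0).expect f = f PUnit.unit :=
  PMF.expect_pure _ f

theorem expect_refLaw_zero (f : Prefix S 0 → ℝ≥0∞) :
    (m.refLaw s₀ 0).expect f = f PUnit.unit :=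
  PMF.expect_pure _ f

theorem expect_refLaw_succ (t : ℕ) (f : Prefix S (t + 1) → ℝ≥0∞) :
    (m.refLaw s₀ (t + 1)).expect f =
      (m.refLaw s₀ t).expect fun s => (m.piRef t s₀ s).expect fun a => f (s, a) := by
  rw [refLaw, PMF.expect_bind]
  congr 1 with s
  exact PMF.expect_map _ _ f

theorem sum_pool_pos {α : Type u} (v : α → ℝ≥0) (hv : ∀ a, 0 < v a) (c : Fin M → α) :
    0 < ∑ j, v (c j) :=
  Finset.sum_pos (fun _ _ => hv _) ⟨0, Finset.mem_univ _⟩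

theorem poolsWeight_pos : ∀ t P, 0 < m.poolsWeight s₀ M t P
  | 0, _ => one_pos
  | t + 1, P => mul_pos (poolsWeight_pos t P.1) (div_pos (m.V_pos _ _ _)
      (div_pos (sum_pool_pos M (fun a => m.V (t + 1) s₀ (poolsPath M t P.1, a))
        (fun _ => m.V_pos _ _ _) P.2.1) (by exact_mod_cast M.pos)))

theorem poolsRatio_pos (t : ℕ) (P : Pools S M t) : 0 < m.poolsRatio s₀ M t P :=
  div_pos (m.V_pos _ _ _) (m.poolsWeight_pos s₀ M t P)

/-- Weighted selection from a pool, corrected by the weight, is uniform selection. -/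
theorem expect_categorical_div (v : Fin M → ℝ≥0) (hv : ∀ j, 0 < v j) (w : ℝ≥0) (hw : 0 < w)
    (g : Fin M → ℝ≥0∞) :
    ((categorical M v hv).expect fun A =>
      (((w * (v A / ((∑ j, v j) / (M : ℕ))))⁻¹ : ℝ≥0) : ℝ≥0∞) * g A) =
      ((w⁻¹ : ℝ≥0) : ℝ≥0∞) * (((M : ℕ) : ℝ≥0)⁻¹ : ℝ≥0) * ∑ j, g j := by
  have hs : 0 < ∑ j, v j := Finset.sum_pos (fun _ _ => hv _) ⟨0, Finset.mem_univ _⟩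
  have hM : ((M : ℕ) : ℝ≥0) ≠ 0 := by exact_mod_cast M.pos.ne'
  rw [PMF.expect_fintype, Finset.mul_sum]
  refine Finset.sum_congr rfl fun A _ => ?_
  have h1 : categorical M v hv A = ((v A / ∑ j, v j : ℝ≥0) : ℝ≥0∞) := by
    rw [categorical, PMF.normalize_apply, tsum_fintype, div_eq_mul_inv, ENNReal.coe_mul,
      ENNReal.coe_inv hs.ne', ENNReal.ofNNReal_finsetSum]
  rw [h1, ← mul_assoc, ← ENNReal.coe_mul, ← ENNReal.coe_mul]
  congr 2
  have := (hv A).ne'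
  have := hs.ne'
  have := hw.ne'
  field_simp

/-- Inverse weights make the proposals unbiased for the base model. -/
theorem expect_inv_poolsWeight : ∀ (t : ℕ) (f : Prefix S t → ℝ≥0∞),
    ((m.poolsLaw s₀ M t).expect fun P =>
      (((m.poolsWeight s₀ M t P)⁻¹ : ℝ≥0) : ℝ≥0∞) * f (poolsPath M t P)) =
      (m.refLaw s₀ t).expect f
  | 0, f => by simp [expect_poolsLaw_zero, expect_refLaw_zero, poolsWeight, poolsPath]
  | t + 1, f => by
    have hM : ((M : ℕ) : ℝ≥0) ≠ 0 := by exact_mod_cast M.pos.ne'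
    rw [expect_poolsLaw_succ, expect_refLaw_succ, ← expect_inv_poolsWeight t]
    congr 1 with P
    have h1 : ∀ c : Fin M → S (t + 1),
        ((categorical M (fun j => m.V (t + 1) s₀ (poolsPath M t P, c j))
          fun _ => m.V_pos _ _ _).expect fun A =>
            (((m.poolsWeight s₀ M (t + 1) (P, (c, A)))⁻¹ : ℝ≥0) : ℝ≥0∞) *
              f (poolsPath M (t + 1) (P, (c, A)))) =
        (((m.poolsWeight s₀ M t P)⁻¹ : ℝ≥0) : ℝ≥0∞) * (((M : ℕ) : ℝ≥0)⁻¹ : ℝ≥0) *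
          ∑ j, f (poolsPath M t P, c j) := fun c =>
      expect_categorical_div M (fun j => m.V (t + 1) s₀ (poolsPath M t P, c j))
        (fun _ => m.V_pos _ _ _) _ (m.poolsWeight_pos s₀ M t P)
        (fun A => f (poolsPath M t P, c A))
    simp only [h1]
    rw [PMF.expect_mul_left, Prog.expect_drawPool_sum _ fun a => f (poolsPath M t P, a),
      mul_assoc, ← mul_assoc _ ((M : ℕ) : ℝ≥0∞)]
    have h2 : ((((M : ℕ) : ℝ≥0)⁻¹ : ℝ≥0) : ℝ≥0∞) * ((M : ℕ) : ℝ≥0∞) = 1 := by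
      have : (((M : ℕ) : ℝ≥0) : ℝ≥0∞) = ((M : ℕ) : ℝ≥0∞) := ENNReal.coe_natCast _
      rw [← this, ← ENNReal.coe_mul, inv_mul_cancel₀ hM, ENNReal.coe_one]
    rw [h2, one_mul]

/-- The stationary law on records thus has the target as its path marginal, for every pool size. -/
theorem expect_poolsRatio (t : ℕ) (f : Prefix S t → ℝ≥0∞) :
    ((m.poolsLaw s₀ M t).expect fun P => m.poolsRatio s₀ M t P * f (poolsPath M t P)) =
      (m.refLaw s₀ t).expect fun s => m.V t s₀ s * f s := by
  rw [← m.expect_inv_poolsWeight s₀ M t]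
  congr 1 with P
  rw [poolsRatio, div_eq_inv_mul, ENNReal.coe_mul]
  ring

/-- The reward of the selected state cancels between terminal reward and weight, leaving an average
over the pool. -/
theorem poolsRatio_succ (t : ℕ) (P : Pools S M t) (c : Fin M → S (t + 1)) (A : Fin M) :
    m.poolsRatio s₀ M (t + 1) (P, (c, A)) = m.poolsRatio s₀ M t P *
      ((∑ j, m.V (t + 1) s₀ (poolsPath M t P, c j) / m.V t s₀ (poolsPath M t P)) /
        (M : ℕ)) := by
  have h1 : (m.V (t + 1) s₀ (poolsPath M t P, c A)) ≠ 0 := (m.V_pos _ _ _).ne'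
  have h2 : (m.V t s₀ (poolsPath M t P)) ≠ 0 := (m.V_pos _ _ _).ne'
  have h3 := (m.poolsWeight_pos s₀ M t P).ne'
  have h4 := (sum_pool_pos M (fun a => m.V (t + 1) s₀ (poolsPath M t P, a))
        (fun _ => m.V_pos _ _ _) c).ne'
  have hM : ((M : ℕ) : ℝ≥0) ≠ 0 := by exact_mod_cast M.pos.ne'
  rw [← Finset.sum_div]
  simp only [poolsRatio, poolsPath, poolsWeight]
  field_simp

variable {m s₀ M}

/-! ### Consequences of the bounds on the reward model -/

/-- Clearing the denominator needs a mean that is neither zero nor infinite; the first Bellman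
inequality excludes zero, the second infinity. -/
theorem BellmanBound.V_le {T : ℕ} {ε : ℝ} (h : m.BellmanBound s₀ T ε) {t : ℕ} (ht : t < T)
    (s : Prefix S t) :
    (m.V t s₀ s : ℝ≥0∞) ≤ ENNReal.ofReal (1 + ε) * m.nextMean s₀ t s := by
  have h1 := (h t ht s).1
  by_cases h0 : m.nextMean s₀ t s = 0
  · rw [h0, ENNReal.div_zero (by exact_mod_cast (m.V_pos t s₀ s).ne')] at h1
    exact absurd (top_le_iff.1 h1) ENNReal.ofReal_ne_top
  · by_cases h2 : m.nextMean s₀ t s = ∞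
    · have h3 := (h t ht s).2
      rw [h2, ENNReal.top_div_coe] at h3
      exact absurd (top_le_iff.1 h3) ENNReal.ofReal_ne_top
    · rwa [ENNReal.div_le_iff_le_mul (Or.inl h0) (Or.inl h2)] at h1

theorem BellmanBound.expect_V_div_le {T : ℕ} {ε : ℝ} (h : m.BellmanBound s₀ T ε) {t : ℕ}
    (ht : t < T) (s : Prefix S t) :
    ((m.piRef t s₀ s).expect fun a => ((m.V (t + 1) s₀ (s, a) / m.V t s₀ s : ℝ≥0) : ℝ≥0∞)) ≤
      ENNReal.ofReal (1 + ε) := by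
  have h0 := (m.V_pos t s₀ s).ne'
  refine le_trans (le_of_eq ?_) (h t ht s).2
  rw [nextMean, div_eq_mul_inv, ← ENNReal.coe_inv h0]
  simp only [div_eq_mul_inv, ENNReal.coe_mul]
  rw [PMF.expect_mul_right]
  rfl

/-- Bellman errors accumulate multiplicatively; this keeps the normalising constant from being
small. -/
theorem BellmanBound.V_zero_le {T : ℕ} {ε : ℝ} (h : m.BellmanBound s₀ T ε) :
    ∀ t ≤ T, (m.V 0 s₀ PUnit.unit : ℝ≥0∞) ≤
      ENNReal.ofReal (1 + ε) ^ t * (m.refLaw s₀ t).expect fun s => m.V t s₀ s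
  | 0, _ => by simp [expect_refLaw_zero]
  | t + 1, ht => by
    refine (h.V_zero_le t (by omega)).trans ?_
    rw [pow_succ, mul_assoc]
    gcongr
    rw [expect_refLaw_succ, ← PMF.expect_mul_left]
    refine PMF.expect_mono _ fun s => ?_
    exact h.V_le ht s

theorem BellmanBound.expect_V_ne_top {T : ℕ} {ε : ℝ} (h : m.BellmanBound s₀ T ε) :
    ∀ t ≤ T, ((m.refLaw s₀ t).expect fun s => (m.V t s₀ s : ℝ≥0∞)) ≠ ∞
  | 0, _ => by simp [expect_refLaw_zero]
  | t + 1, ht => by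
    have h1 : ((m.refLaw s₀ (t + 1)).expect fun s => (m.V (t + 1) s₀ s : ℝ≥0∞)) ≤
        ENNReal.ofReal (1 + ε) * (m.refLaw s₀ t).expect fun s => (m.V t s₀ s : ℝ≥0∞) := by
      rw [expect_refLaw_succ, ← PMF.expect_mul_left]
      refine PMF.expect_mono _ fun s => ?_
      have h0 : (m.V t s₀ s : ℝ≥0∞) ≠ 0 := by exact_mod_cast (m.V_pos t s₀ s).ne'
      exact (ENNReal.div_le_iff_le_mul (Or.inl h0) (Or.inl ENNReal.coe_ne_top)).1 (h t ht s).2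
    exact ne_top_of_le_ne_top
      (ENNReal.mul_ne_top ENNReal.ofReal_ne_top (h.expect_V_ne_top t (by omega))) h1

/-- Of a ratio and its reciprocal one is at least `1`. Needed to absorb the rounding of the pool
size. -/
theorem RatioBound.one_le {T : ℕ} {L : ℝ} (h : m.RatioBound s₀ T L) (hT : 0 < T) : 1 ≤ L := by
  obtain ⟨a, -⟩ := (m.piRef 0 s₀ PUnit.unit).support_nonempty
  obtain ⟨h1, h2⟩ := h 0 hT PUnit.unit a
  have p0 : (0 : ℝ) < m.V 0 s₀ PUnit.unit := by exact_mod_cast m.V_pos 0 s₀ PUnit.unit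
  have p1 : (0 : ℝ) < m.V (0 + 1) s₀ (PUnit.unit, a) := by
    exact_mod_cast m.V_pos (0 + 1) s₀ (PUnit.unit, a)
  rcases le_total (m.V 0 s₀ PUnit.unit : ℝ) (m.V (0 + 1) s₀ (PUnit.unit, a)) with h3 | h3
  · exact le_trans ((one_le_div p0).2 h3) h2
  · exact le_trans ((one_le_div p1).2 h3) h1

/-- Moments of the importance ratio. -/
theorem expect_poolsRatio_pow_le {T : ℕ} {L ε η : ℝ} {k : ℕ} (hL : m.RatioBound s₀ T L)
    (hB : m.BellmanBound s₀ T ε) (hε : 0 ≤ ε) (hη : 0 ≤ η) (hη1 : η ≤ 1)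
    (hk : k * L ≤ (M : ℕ) * η) :
    ∀ t ≤ T, ((m.poolsLaw s₀ M t).expect fun P => (m.poolsRatio s₀ M t P : ℝ≥0∞) ^ k) ≤
      ENNReal.ofReal (Real.exp (k * ((1 + η) * (1 + ε) - 1))) ^ t *
        (m.V 0 s₀ PUnit.unit : ℝ≥0∞) ^ k
  | 0, _ => by simp [expect_poolsLaw_zero, poolsRatio, poolsPath, poolsWeight]
  | t + 1, ht => by
    rw [expect_poolsLaw_succ, pow_succ', mul_assoc]
    refine le_trans ?_ (mul_le_mul_right
      (expect_poolsRatio_pow_le hL hB hε hη hη1 hk t (by omega)) _)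
    rw [← PMF.expect_mul_left]
    refine PMF.expect_mono _ fun P => ?_
    -- The selected index has dropped out, so only the moment of a mean of independent ratios
    -- remains.
    simp only [poolsRatio_succ, PMF.expect_const, ENNReal.coe_mul, mul_pow]
    rw [PMF.expect_mul_left, mul_comm]
    gcongr
    refine Prog.expect_drawPool_mean_pow_le _
      (fun a => m.V (t + 1) s₀ (poolsPath M t P, a) / m.V t s₀ (poolsPath M t P)) M.pos hη hη1
      (by linarith) hk (fun a => ?_) (hB.expect_V_div_le ht _)
    push_cast
    exact (hL t ht _ a).2

end ReasoningModel

/-! ### Total variation distance -/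

theorem PMF.toReal_toOuterMeasure_add_compl {α : Type u} (p : PMF α) (A : Set α) :
    (p.toOuterMeasure A).toReal + (p.toOuterMeasure Aᶜ).toReal = 1 := by
  have h : p.toOuterMeasure A + p.toOuterMeasure Aᶜ = 1 := by
    simp only [PMF.toOuterMeasure_eq_expect]
    rw [← PMF.expect_add, ← PMF.expect_const p 1]
    congr 1 with a
    by_cases ha : a ∈ A <;> simp [ha]
  have h1 : p.toOuterMeasure A ≠ ∞ := fun h0 => by simp [h0] at h
  have h2 : p.toOuterMeasure Aᶜ ≠ ∞ := fun h0 => by simp [h0] at h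
  rw [← ENNReal.toReal_add h1 h2, h, ENNReal.toReal_one]

/-- Two laws that dominate multiples of a common law are close. -/
theorem tvDist_le_of_dominate {α : Type u} (p q : PMF α) (ρ : Set α → ℝ) {a b : ℝ}
    (hρ0 : ∀ A, 0 ≤ ρ A) (hρ : ∀ A, ρ A + ρ Aᶜ = 1) (ha : a ≤ 1) (hb : b ≤ 1)
    (hp : ∀ A, a * ρ A ≤ (p.toOuterMeasure A).toReal)
    (hq : ∀ A, b * ρ A ≤ (q.toOuterMeasure A).toReal) :
    tvDist p q ≤ (1 - a) + (1 - b) := by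
  refine ciSup_le fun A => ?_
  have h1 := p.toReal_toOuterMeasure_add_compl A
  have h2 := q.toReal_toOuterMeasure_add_compl A
  have h3 := hρ A
  have h4 := hp A
  have h5 := hp Aᶜ
  have h6 := hq A
  have h7 := hq Aᶜ
  have h8 := hρ0 A
  have h9 := hρ0 Aᶜ
  -- Domination on `A` bounds from below, on `Aᶜ` from above: `p(A) - q(A) ≤ 1 - a ρ(Aᶜ) - b ρ(A)`,
  -- and `1 = ρ(A) + ρ(Aᶜ)`.
  rw [abs_le]
  constructor <;> nlinarith

namespace ReasoningModel

variable {S : ℕ → Type u}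

/-! ### The running time -/

variable (m : ReasoningModel S) (s₀ : S 0) (M : ℕ+)

theorem costLE_proposal : ∀ t, (m.proposal s₀ M t).CostLE (1 + t * (5 * M + 4))
  | 0 => ((Prog.costLE_tick 1).bind fun _ => Prog.costLE_ret _).mono (by omega)
  | t + 1 => by
    refine (Prog.CostLE.bind (costLE_proposal t) fun x =>
      (Prog.costLE_drawPool _ _).bind fun c => (Prog.costLE_tick _).bind fun _ =>
        (Prog.costLE_tick _).bind fun _ => (Prog.costLE_draw _ _).bind fun A =>
          (Prog.costLE_tick _).bind fun _ => Prog.costLE_ret _).mono ?_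
    rw [add_mul]
    omega

/-- The constant `11` is `1` to initialise a proposal plus `6 + 2 + 2` for the acceptance step. -/
theorem costLE_mhLoop (T : ℕ) :
    ∀ k, (m.mhLoop s₀ M T k).CostLE ((k + 1) * (T * (5 * M + 4) + 11))
  | 0 => (Prog.CostLE.bind (m.costLE_proposal s₀ M T) fun y =>
      (Prog.costLE_tick _).bind fun _ => Prog.costLE_ret _).mono (by omega)
  | k + 1 => by
    refine (Prog.CostLE.bind (costLE_mhLoop T k) fun x =>
      (m.costLE_proposal s₀ M T).bind fun y => (Prog.costLE_tick _).bind fun _ =>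
        (Prog.costLE_draw _ _).bind fun A =>
          (Prog.costLE_tick _).bind fun _ => Prog.costLE_ret _).mono ?_
    rw [add_mul (k + 1) 1]
    omega

/-! ### The algorithm as an independent Metropolis–Hastings chain -/

/-- Records of pools whose importance ratio is at most `B`. -/
def goodPools (T : ℕ) (B : ℝ≥0) : Set (Pools S M T) := {P | m.poolsRatio s₀ M T P ≤ B}

/-- Runs all of whose proposals have importance ratio at most `B`. -/
def goodRuns (T : ℕ) (B : ℝ≥0) : Set (Run S M T) :=
  {r | ∀ h ∈ r.history, h.1 ∈ m.goodPools s₀ M T B}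

theorem acceptProb_ofPools {T : ℕ} (x : Run S M T) (P : Pools S M T) :
    m.acceptProb s₀ x (m.ofPools s₀ M T P) =
      IndepMH.accept (m.V T s₀ x.path / x.weight) (m.poolsRatio s₀ M T P) := by
  simp only [acceptProb, IndepMH.accept, poolsRatio, ofPools]
  rw [div_div_div_eq, mul_comm x.weight]

theorem indicator_goodRuns_cons {T : ℕ} (B : ℝ≥0) (x : Run S M T) (P : Pools S M T) (a : Bool)
    (s : Prefix S T) (w : ℝ≥0) :
    (m.goodRuns s₀ M T B).indicator (1 : Run S M T → ℝ≥0∞) ⟨(P, a) :: x.history, s, w⟩ =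
      (m.goodRuns s₀ M T B).indicator 1 x * (m.goodPools s₀ M T B).indicator 1 P := by
  by_cases h1 : x ∈ m.goodRuns s₀ M T B <;> by_cases h2 : P ∈ m.goodPools s₀ M T B <;>
    · have h3 : ((⟨(P, a) :: x.history, s, w⟩ : Run S M T) ∈ m.goodRuns s₀ M T B) ↔
          P ∈ m.goodPools s₀ M T B ∧ x ∈ m.goodRuns s₀ M T B := by
        simp only [goodRuns, Set.mem_ofPred_eq, List.forall_mem_cons]
      simp [Set.indicator, h1, h2, h3]

theorem expect_mhStep {T : ℕ} (x : Run S M T) (F : Run S M T → ℝ≥0∞) :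
    (m.mhStep s₀ M T x).law.expect F = (m.poolsLaw s₀ M T).expect fun P =>
      IndepMH.accept (m.V T s₀ x.path / x.weight) (m.poolsRatio s₀ M T P) *
        F ⟨(P, true) :: x.history, poolsPath M T P, m.poolsWeight s₀ M T P⟩ +
      (1 - IndepMH.accept (m.V T s₀ x.path / x.weight) (m.poolsRatio s₀ M T P) : ℝ≥0) *
        F ⟨(P, false) :: x.history, x.path, x.weight⟩ := by
  simp only [mhStep, Prog.law_bind, proposal_law, PMF.bind_map, Prog.law_tick, PMF.pure_bind,
    Prog.law_draw, Prog.law_ret, PMF.expect_bind, Function.comp_apply, PMF.expect_bernoulli,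
    PMF.expect_pure, acceptProb_ofPools]
  rfl

/-- The good-run indicator is a product over all proposals, accepted or not, so each factor enters
the transition of its own iteration. -/
theorem expect_mhLoop (T : ℕ) (B : ℝ≥0) : ∀ (k : ℕ) (φ : Prefix S T → ℝ≥0 → ℝ≥0∞),
    ((m.mhLoop s₀ M T k).law.expect fun r =>
      (m.goodRuns s₀ M T B).indicator 1 r * φ r.path r.weight) =
      IndepMH.iter (m.poolsLaw s₀ M T) (m.goodPools s₀ M T B) (m.poolsRatio s₀ M T) k
        (fun P => φ (poolsPath M T P) (m.poolsWeight s₀ M T P))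
  | 0, φ => by
    simp only [mhLoop, Prog.law_bind, proposal_law, PMF.bind_map, Prog.law_tick, PMF.pure_bind,
      Prog.law_ret, PMF.expect_bind, Function.comp_apply, PMF.expect_pure, IndepMH.iter]
    congr 1 with P
    congr 1
    have h : (⟨[(P, true)], poolsPath M T P, m.poolsWeight s₀ M T P⟩ : Run S M T) ∈
        m.goodRuns s₀ M T B ↔ P ∈ m.goodPools s₀ M T B := by
      simp only [goodRuns, Set.mem_ofPred_eq, List.forall_mem_singleton]
    by_cases hP : P ∈ m.goodPools s₀ M T B <;> simp [Set.indicator, ofPools, h, hP]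
  | k + 1, φ => by
    -- The test function is one transition applied to `φ`; it involves the weight through the
    -- acceptance probability, hence the second argument of `φ`.
    have h := expect_mhLoop T B k fun s w => (m.poolsLaw s₀ M T).expect fun P =>
      (m.goodPools s₀ M T B).indicator 1 P *
        (IndepMH.accept (m.V T s₀ s / w) (m.poolsRatio s₀ M T P) *
          φ (poolsPath M T P) (m.poolsWeight s₀ M T P) +
        (1 - IndepMH.accept (m.V T s₀ s / w) (m.poolsRatio s₀ M T P) : ℝ≥0) * φ s w)
    refine Eq.trans ?_ h
    rw [mhLoop, Prog.law_bind, PMF.expect_bind]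
    congr 1 with x
    rw [expect_mhStep, ← PMF.expect_mul_left]
    congr 1 with P
    simp only [indicator_goodRuns_cons]
    ring

theorem toOuterMeasure_goodRuns (T : ℕ) (B : ℝ≥0) (k : ℕ) :
    (m.mhLoop s₀ M T k).law.toOuterMeasure (m.goodRuns s₀ M T B) =
      (m.poolsLaw s₀ M T).toOuterMeasure (m.goodPools s₀ M T B) ^ (k + 1) := by
  have h := m.expect_mhLoop s₀ M T B k fun _ _ => 1
  rw [IndepMH.iter_const] at h
  simpa only [mul_one, ← PMF.toOuterMeasure_eq_expect] using h

theorem toOuterMeasure_outputGiven (T : ℕ) (H : ℕ+) (B : ℝ≥0)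
    (hE : ∃ r ∈ m.goodRuns s₀ M T B, r ∈ (m.resamplingMH s₀ T M H).law.support)
    (A : Set (Prefix S T)) :
    (m.outputGiven s₀ T M H (m.goodRuns s₀ M T B) hE).toOuterMeasure A =
      IndepMH.iter (m.poolsLaw s₀ M T) (m.goodPools s₀ M T B) (m.poolsRatio s₀ M T) (H - 1 : ℕ)
        (fun P => A.indicator 1 (poolsPath M T P)) *
      ((m.poolsLaw s₀ M T).toOuterMeasure (m.goodPools s₀ M T B) ^ (H : ℕ))⁻¹ := by
  have h := m.toOuterMeasure_goodRuns s₀ M T B (H - 1 : ℕ)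
  rw [Nat.sub_add_cancel H.pos] at h
  rw [outputGiven, PMF.toOuterMeasure_map_apply, PMF.toOuterMeasure_eq_expect, PMF.expect,
    ← m.expect_mhLoop s₀ M T B (H - 1 : ℕ) fun s _ => A.indicator 1 s, PMF.expect,
    ← ENNReal.tsum_mul_right, ← h, PMF.toOuterMeasure_apply]
  congr 1 with r
  rw [PMF.filter_apply, resamplingMH]
  by_cases h1 : r ∈ m.goodRuns s₀ M T B <;> by_cases h2 : r.path ∈ A <;>
    simp [Set.indicator, h1, h2]

theorem toOuterMeasure_target {T : ℕ} {L : ℝ} (hL : m.RatioBound s₀ T L)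
    (A : Set (Prefix S T)) :
    (m.target s₀ T hL).toOuterMeasure A =
      ((m.poolsLaw s₀ M T).expect fun P =>
        m.poolsRatio s₀ M T P * A.indicator 1 (poolsPath M T P)) *
      ((m.poolsLaw s₀ M T).expect fun P => (m.poolsRatio s₀ M T P : ℝ≥0∞))⁻¹ := by
  have h := m.expect_poolsRatio s₀ M T fun _ => 1
  simp only [mul_one] at h
  rw [h, m.expect_poolsRatio s₀ M T, PMF.toOuterMeasure_eq_expect, PMF.expect, PMF.expect,
    PMF.expect, ← ENNReal.tsum_mul_right]
  congr 1 with s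
  rw [target, PMF.normalize_apply]
  ring

/-! ### Total variation bound for the conditioned output. -/

variable {m s₀ M}

/-- The output given good runs is close to the target if bad proposals contribute little to the
normalising constant. -/
theorem tvDist_outputGiven_le {T : ℕ} {L : ℝ} (hL : m.RatioBound s₀ T L) {H : ℕ+} {B r s : ℝ≥0}
    (hB0 : 0 < B) (hrs : r + s = 1) (hr0 : 0 < r) {c N : ℝ} {τ : ℝ}
    (hE : ∃ r ∈ m.goodRuns s₀ M T B, r ∈ (m.resamplingMH s₀ T M H).law.support)
    (hg : (m.poolsLaw s₀ M T).toOuterMeasure (m.goodPools s₀ M T B) ≠ 0)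
    (hc : IndepMH.stat (m.poolsLaw s₀ M T) (m.goodPools s₀ M T B) (m.poolsRatio s₀ M T) 1 =
      ENNReal.ofReal c)
    (hN : ((m.poolsLaw s₀ M T).expect fun P => (m.poolsRatio s₀ M T P : ℝ≥0∞)) =
      ENNReal.ofReal N)
    (hN0 : 0 < N) (hrB : r * B ≤ c) (hcN : c ≤ N) (hτ : (1 - τ) * N ≤ c) :
    tvDist (m.outputGiven s₀ T M H (m.goodRuns s₀ M T B) hE) (m.target s₀ T hL) ≤
      (s : ℝ) ^ (H : ℕ) + τ := by
  set Q := m.poolsLaw s₀ M T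
  set G := m.goodPools s₀ M T B
  set ω := m.poolsRatio s₀ M T
  set I : Set (Prefix S T) → Pools S M T → ℝ≥0∞ := fun A P => A.indicator 1 (poolsPath M T P)
  set π : Set (Prefix S T) → ℝ≥0∞ := fun A => IndepMH.stat Q G ω (I A) with hπ
  have hc0 : 0 < c := lt_of_lt_of_le (by exact_mod_cast mul_pos hr0 hB0) hrB
  have hI : ∀ A P, I A P ≤ 1 := fun A P =>
    Set.indicator_le_self' (s := A) (f := 1) (fun _ _ => zero_le) (poolsPath M T P)
  have hπc : ∀ A, π A ≤ ENNReal.ofReal c := fun A => by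
    rw [← hc]
    exact IndepMH.stat_mono fun P _ => hI A P
  have hπt : ∀ A, π A ≠ ∞ := fun A => ne_top_of_le_ne_top ENNReal.ofReal_ne_top (hπc A)
  have hsum : ∀ A, (π A).toReal + (π Aᶜ).toReal = c := by
    intro A
    rw [← ENNReal.toReal_add (hπt _) (hπt _), hπ]
    simp only
    rw [← IndepMH.stat_add, ← ENNReal.toReal_ofReal hc0.le, ← hc]
    congr 2 with P
    by_cases h : poolsPath M T P ∈ A <;> simp [I, h]
  set g := Q.toOuterMeasure G
  have hg1 : g ≤ 1 := by
    rw [show g = _ from PMF.toOuterMeasure_eq_expect _ _, ← PMF.expect_const Q 1]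
    exact PMF.expect_mono _ fun y => Set.indicator_le_self' (by simp) y
  have hgt : g ^ (H : ℕ) ≠ ∞ :=
    ENNReal.pow_ne_top (ne_top_of_le_ne_top ENNReal.one_ne_top hg1)
  have hg0 : g ^ (H : ℕ) ≠ 0 := pow_ne_zero _ hg
  have hs1 : s ≤ 1 := hrs ▸ le_add_self
  have hsH : s ^ (H : ℕ) ≤ 1 := pow_le_one₀ zero_le hs1
  -- The common law is the path marginal of the stationary law on good records. Ergodicity gives the
  -- output the factor `1 - s ^ H`; good records carry the share `c / N` of the target.
  have key := tvDist_le_of_dominate (m.outputGiven s₀ T M H (m.goodRuns s₀ M T B) hE)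
    (m.target s₀ T hL) (fun A => (π A).toReal / c) (a := 1 - (s : ℝ) ^ (H : ℕ)) (b := c / N)
    (fun A => by positivity) (fun A => by rw [← add_div, hsum, div_self hc0.ne'])
    (by linarith [pow_nonneg s.coe_nonneg (H : ℕ)]) ((div_le_one hN0).2 hcN)
    (fun A => ?_) (fun A => ?_)
  · have : 1 - τ ≤ c / N := (le_div_iff₀ hN0).2 hτ
    linarith
  · have h1 := IndepMH.stat_le_iter (Q := Q) (G := G) (ω := ω) (m.poolsRatio_pos s₀ M T) hB0
      (fun _ h => h) hrs (by rw [hc, ← ENNReal.ofReal_coe_nnreal, ← ENNReal.ofReal_coe_nnreal,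
        ← ENNReal.ofReal_mul r.coe_nonneg]; exact ENNReal.ofReal_le_ofReal hrB)
      (by rw [hc]; exact ENNReal.ofReal_ne_top) hr0 (H - 1 : ℕ) (I A) (hπt A)
    rw [Nat.sub_add_cancel H.pos] at h1
    have hout : (m.outputGiven s₀ T M H (m.goodRuns s₀ M T B) hE).toOuterMeasure A =
        IndepMH.iter Q G ω (H - 1 : ℕ) (I A) * (g ^ (H : ℕ))⁻¹ :=
      m.toOuterMeasure_outputGiven s₀ M T H B hE A
    have h2 : ((1 - s ^ (H : ℕ) : ℝ≥0) : ℝ≥0∞) * π A ≤ ENNReal.ofReal c *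
        (m.outputGiven s₀ T M H (m.goodRuns s₀ M T B) hE).toOuterMeasure A := by
      rw [hout, ← hc, ← mul_assoc, ← div_eq_mul_inv]
      refine (ENNReal.le_div_iff_mul_le (Or.inl hg0) (Or.inl hgt)).2 ?_
      refine le_trans (le_of_eq ?_) h1
      ring
    have hot : (m.outputGiven s₀ T M H (m.goodRuns s₀ M T B) hE).toOuterMeasure A ≠ ∞ := by
      rw [PMF.toOuterMeasure_apply]
      exact PMF.tsum_coe_indicator_ne_top _ _
    have h3 := ENNReal.toReal_mono (ENNReal.mul_ne_top ENNReal.ofReal_ne_top hot) h2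
    rw [ENNReal.toReal_mul, ENNReal.toReal_mul, ENNReal.toReal_ofReal hc0.le,
      ENNReal.coe_toReal, NNReal.coe_sub hsH] at h3
    push_cast at h3
    rw [← mul_div_assoc, div_le_iff₀ hc0]
    linarith
  · have ht := m.toOuterMeasure_target s₀ M hL A
    rw [hN] at ht
    have h2 : π A ≤ ENNReal.ofReal N * (m.target s₀ T hL).toOuterMeasure A := by
      rw [ht, mul_comm, mul_assoc, ENNReal.inv_mul_cancel
        (by simpa using hN0) ENNReal.ofReal_ne_top, mul_one]
      refine PMF.expect_mono _ fun P => ?_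
      rw [mul_assoc]
      refine mul_le_of_le_one_left zero_le ?_
      exact Set.indicator_le_self' (s := G) (f := 1) (fun _ _ => zero_le) P
    have hot : (m.target s₀ T hL).toOuterMeasure A ≠ ∞ := by
      rw [PMF.toOuterMeasure_apply]
      exact PMF.tsum_coe_indicator_ne_top _ _
    have h3 := ENNReal.toReal_mono (ENNReal.mul_ne_top ENNReal.ofReal_ne_top hot) h2
    rw [ENNReal.toReal_mul, ENNReal.toReal_ofReal hN0.le] at h3
    rw [div_mul_div_cancel₀' hc0.ne', div_le_iff₀ hN0]
    linarith

end ReasoningModel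

/-! ### Tail of the importance ratio and accuracy of the algorithm. -/

namespace ReasoningModel

variable {S : ℕ → Type u} {m : ReasoningModel S} {s₀ : S 0} {M : ℕ+}

/-- Probability and contribution to the normalising constant of the bad proposals. -/
theorem bad_pools_le {T : ℕ} {a : ℝ} {k : ℕ}
    (hmom : ((m.poolsLaw s₀ M T).expect fun P => (m.poolsRatio s₀ M T P : ℝ≥0∞) ^ k) ≤
      ENNReal.ofReal (Real.exp (k * a)) * (m.V 0 s₀ PUnit.unit : ℝ≥0∞) ^ k) (hk : 0 < k)
    {B : ℝ≥0} (hB : (B : ℝ) = Real.exp (a + 1) * m.V 0 s₀ PUnit.unit) :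
    (m.poolsLaw s₀ M T).toOuterMeasure (m.goodPools s₀ M T B)ᶜ ≤
        ENNReal.ofReal (Real.exp (-k)) ∧
      ((m.poolsLaw s₀ M T).expect fun P =>
        (m.goodPools s₀ M T B)ᶜ.indicator 1 P * (m.poolsRatio s₀ M T P : ℝ≥0∞)) ≤
        B * ENNReal.ofReal (Real.exp (-k)) := by
  set V₀ := m.V 0 s₀ PUnit.unit
  have hV : 0 < (V₀ : ℝ) := by exact_mod_cast m.V_pos 0 s₀ PUnit.unit
  have hB0 : (B : ℝ≥0∞) ≠ 0 := by
    have : (0 : ℝ) < B := by rw [hB]; positivity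
    exact_mod_cast this.ne'
  have hBk0 : (B : ℝ≥0∞) ^ k ≠ 0 := pow_ne_zero _ hB0
  have hBkt : (B : ℝ≥0∞) ^ k ≠ ∞ := ENNReal.pow_ne_top ENNReal.coe_ne_top
  -- The `+ 1` in the exponent of `B` produces the factor `exp (-k)`.
  have hmom' : ((m.poolsLaw s₀ M T).expect fun P => (m.poolsRatio s₀ M T P : ℝ≥0∞) ^ k) ≤
      B ^ k * ENNReal.ofReal (Real.exp (-k)) := by
    refine hmom.trans (le_of_eq ?_)
    rw [← ENNReal.ofReal_coe_nnreal, ← ENNReal.ofReal_coe_nnreal, hB,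
      ← ENNReal.ofReal_pow hV.le, ← ENNReal.ofReal_pow (by positivity),
      ← ENNReal.ofReal_mul (by positivity), ← ENNReal.ofReal_mul (by positivity), mul_pow,
      ← Real.exp_nat_mul, mul_right_comm, ← Real.exp_add]
    congr 4
    ring
  constructor
  · rw [← ENNReal.mul_le_mul_iff_right hBk0 hBkt, PMF.toOuterMeasure_eq_expect,
      ← PMF.expect_mul_left]
    refine (PMF.expect_mono _ fun P => ?_).trans hmom'
    by_cases hP : m.poolsRatio s₀ M T P ≤ B
    · simp [goodPools, hP]
    · have h1 : (B : ℝ≥0∞) ≤ m.poolsRatio s₀ M T P := by exact_mod_cast (not_le.1 hP).le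
      simp only [goodPools, Set.mem_compl_iff, Set.mem_ofPred_eq, hP, not_false_eq_true,
        Set.indicator_of_mem, Pi.one_apply, mul_one]
      gcongr
  -- Markov's inequality with one power kept: `B ^ (k - 1) * ω ≤ ω ^ k` on bad records.
  · rw [← ENNReal.mul_le_mul_iff_right hBk0 hBkt, ← PMF.expect_mul_left, mul_left_comm]
    refine le_trans ?_ (mul_le_mul_right hmom' _)
    rw [← PMF.expect_mul_left]
    refine PMF.expect_mono _ fun P => ?_
    by_cases hP : m.poolsRatio s₀ M T P ≤ B
    · simp [goodPools, hP]
    · have h1 : (B : ℝ≥0∞) ≤ m.poolsRatio s₀ M T P := by exact_mod_cast (not_le.1 hP).le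
      simp only [goodPools, Set.mem_compl_iff, Set.mem_ofPred_eq, hP, not_false_eq_true,
        Set.indicator_of_mem, Pi.one_apply, one_mul]
      obtain ⟨j, rfl⟩ := Nat.exists_eq_succ_of_ne_zero hk.ne'
      calc (B : ℝ≥0∞) ^ (j + 1) * m.poolsRatio s₀ M T P =
            B * (B ^ j * m.poolsRatio s₀ M T P) := by ring
        _ ≤ B * ((m.poolsRatio s₀ M T P : ℝ≥0∞) ^ j * m.poolsRatio s₀ M T P) := by gcongr
        _ = _ := by rw [Nat.succ_eq_add_one, pow_succ]

/-- Accuracy of the algorithm for given pool size `M`, number `H` of iterations and moment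
order `k`. -/
theorem exists_event_tvDist_le {κ ε L δ δTV : ℝ} {T k : ℕ} {H : ℕ+} (hκ : 0 ≤ κ) (hT : 1 ≤ T)
    (hε : 0 ≤ ε) (hεT : ε ≤ κ / T) (hL : m.RatioBound s₀ T L) (hBell : m.BellmanBound s₀ T ε)
    (hM : k * T * L ≤ (M : ℕ)) (hk : 0 < k) (hδ : δ < 1) (hTV : δTV < 1)
    (hHδ : (H : ℕ) * Real.exp (-k) ≤ δ)
    (hHT : (1 - Real.exp (-(3 * κ + 2)) / 2) ^ (H : ℕ) ≤ δTV / 2)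
    (hkT : Real.exp (3 * κ + 2 - k) ≤ δTV / 2) :
    ∃ (E : Set (Run S M T)) (hE : ∃ r ∈ E, r ∈ (m.resamplingMH s₀ T M H).law.support),
      ENNReal.ofReal (1 - δ) ≤ (m.resamplingMH s₀ T M H).law.toOuterMeasure E ∧
      tvDist (m.outputGiven s₀ T M H E hE) (m.target s₀ T hL) ≤ δTV := by
  have hT0 : (0 : ℝ) < T := by exact_mod_cast hT
  have hT1 : (1 : ℝ) ≤ T := by exact_mod_cast hT
  set V₀ := m.V 0 s₀ PUnit.unit with hV₀
  have hV : 0 < (V₀ : ℝ) := by exact_mod_cast m.V_pos 0 s₀ PUnit.unit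
  set Q := m.poolsLaw s₀ M T with hQ
  set ω := m.poolsRatio s₀ M T with hω
  have hη1 : 1 / (T : ℝ) ≤ 1 := by rw [div_le_one hT0]; exact hT1
  -- With `η = 1 / T` the exponent over `T` steps is `k (1 + ε + ε T) ≤ k (2κ + 1)`.
  have hmom : (Q.expect fun P => (ω P : ℝ≥0∞) ^ k) ≤
      ENNReal.ofReal (Real.exp (k * (2 * κ + 1))) * (V₀ : ℝ≥0∞) ^ k := by
    refine (expect_poolsRatio_pow_le (k := k) (M := M) (η := 1 / T) hL hBell hε (by positivity)
      hη1 ?_ T le_rfl).trans ?_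
    · rw [mul_one_div, le_div_iff₀ hT0]
      linarith
    · gcongr
      rw [← ENNReal.ofReal_pow (by positivity), ← Real.exp_nat_mul]
      apply ENNReal.ofReal_le_ofReal
      apply Real.exp_le_exp.2
      have h1 : ε * T ≤ κ := (le_div_iff₀ hT0).1 hεT
      have h2 : T * ((1 + 1 / (T : ℝ)) * (1 + ε) - 1) = 1 + ε + ε * T := by
        field_simp
        ring
      have h3 : ε ≤ κ := by nlinarith
      calc (T : ℝ) * (k * ((1 + 1 / (T : ℝ)) * (1 + ε) - 1)) =
            k * (T * ((1 + 1 / (T : ℝ)) * (1 + ε) - 1)) := by ring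
        _ ≤ _ := by
          rw [h2]
          exact mul_le_mul_of_nonneg_left (by linarith) (Nat.cast_nonneg k)
  set B : ℝ≥0 := (Real.exp (2 * κ + 1 + 1)).toNNReal * V₀ with hBdef
  have hB : (B : ℝ) = Real.exp (2 * κ + 1 + 1) * V₀ := by
    rw [hBdef, NNReal.coe_mul, Real.coe_toNNReal _ (Real.exp_pos _).le]
  have hB0 : 0 < B := by
    have : (0 : ℝ) < B := by rw [hB]; positivity
    exact_mod_cast this
  obtain ⟨hbadP, hbadE⟩ := bad_pools_le hmom hk hB
  set G := m.goodPools s₀ M T B with hG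
  have hgood : 1 - Real.exp (-k) ≤ (Q.toOuterMeasure G).toReal := by
    have h1 := Q.toReal_toOuterMeasure_add_compl G
    have h2 := ENNReal.toReal_mono ENNReal.ofReal_ne_top hbadP
    rw [ENNReal.toReal_ofReal (Real.exp_pos _).le] at h2
    linarith
  have hek : Real.exp (-k) < 1 := Real.exp_lt_one_iff.2 (by simpa using hk)
  have hGt : Q.toOuterMeasure G ≠ ∞ := by
    rw [PMF.toOuterMeasure_apply]
    exact PMF.tsum_coe_indicator_ne_top _ _
  have hG0 : Q.toOuterMeasure G ≠ 0 := by
    intro h0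
    rw [h0, ENNReal.toReal_zero] at hgood
    linarith
  have hlaw : (m.resamplingMH s₀ T M H).law.toOuterMeasure (m.goodRuns s₀ M T B) =
      Q.toOuterMeasure G ^ (H : ℕ) := by
    have h := m.toOuterMeasure_goodRuns s₀ M T B (H - 1 : ℕ)
    rwa [Nat.sub_add_cancel H.pos] at h
  have hprob : ENNReal.ofReal (1 - δ) ≤
      (m.resamplingMH s₀ T M H).law.toOuterMeasure (m.goodRuns s₀ M T B) := by
    rw [hlaw, ← ENNReal.ofReal_toReal hGt, ← ENNReal.ofReal_pow ENNReal.toReal_nonneg]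
    apply ENNReal.ofReal_le_ofReal
    calc 1 - δ ≤ 1 + (H : ℕ) * (-Real.exp (-k)) := by linarith
      _ ≤ (1 + -Real.exp (-k)) ^ (H : ℕ) := one_add_mul_le_pow (by linarith) _
      _ ≤ _ := by gcongr <;> linarith
  have hE : ∃ r ∈ m.goodRuns s₀ M T B, r ∈ (m.resamplingMH s₀ T M H).law.support := by
    by_contra hno
    have h0 : (m.resamplingMH s₀ T M H).law.toOuterMeasure (m.goodRuns s₀ M T B) = 0 := by
      rw [PMF.toOuterMeasure_apply_eq_zero_iff, Set.disjoint_left]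
      exact fun r hr hr' => hno ⟨r, hr', hr⟩
    rw [h0] at hprob
    have := ENNReal.ofReal_pos.2 (sub_pos.2 hδ)
    exact absurd hprob (not_le.2 this)
  refine ⟨_, hE, hprob, ?_⟩
  have hNref : (Q.expect fun P => (ω P : ℝ≥0∞)) =
      (m.refLaw s₀ T).expect fun s => (m.V T s₀ s : ℝ≥0∞) := by
    simpa using m.expect_poolsRatio s₀ M T fun _ => 1
  have hNt : (Q.expect fun P => (ω P : ℝ≥0∞)) ≠ ∞ := by
    rw [hNref]; exact hBell.expect_V_ne_top T le_rfl
  set N : ℝ := (Q.expect fun P => (ω P : ℝ≥0∞)).toReal with hN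
  have hVN : (V₀ : ℝ) ≤ Real.exp κ * N := by
    have h1 := hBell.V_zero_le T le_rfl
    rw [← hNref] at h1
    have h2 := ENNReal.toReal_mono (ENNReal.mul_ne_top
      (ENNReal.pow_ne_top ENNReal.ofReal_ne_top) hNt) h1
    rw [ENNReal.toReal_mul, ENNReal.toReal_pow, ENNReal.toReal_ofReal (by linarith),
      ENNReal.coe_toReal] at h2
    refine h2.trans ?_
    gcongr
    calc (1 + ε) ^ T ≤ Real.exp ε ^ T := by
          gcongr
          linarith [Real.add_one_le_exp ε]
      _ = Real.exp (T * ε) := (Real.exp_nat_mul _ _).symm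
      _ ≤ _ := Real.exp_le_exp.2 (by
          have := (le_div_iff₀ hT0).1 hεT
          linarith)
  have hN0 : 0 < N := pos_of_mul_pos_right (hV.trans_le hVN) (Real.exp_pos _).le
  have hsplit : IndepMH.stat Q G ω 1 + (Q.expect fun P => Gᶜ.indicator 1 P * (ω P : ℝ≥0∞)) =
      Q.expect fun P => (ω P : ℝ≥0∞) := by
    rw [IndepMH.stat, ← PMF.expect_add]
    congr 1 with P
    by_cases hP : P ∈ G <;> simp [hP]
  have hct : IndepMH.stat Q G ω 1 ≠ ∞ := ne_top_of_le_ne_top hNt (hsplit ▸ le_self_add)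
  have hbt : (Q.expect fun P => Gᶜ.indicator 1 P * (ω P : ℝ≥0∞)) ≠ ∞ :=
    ne_top_of_le_ne_top hNt (hsplit ▸ le_add_self)
  set c : ℝ := (IndepMH.stat Q G ω 1).toReal with hc
  set β : ℝ := (Q.expect fun P => Gᶜ.indicator 1 P * (ω P : ℝ≥0∞)).toReal with hβ
  have hcβ : c + β = N := by rw [hc, hβ, ← ENNReal.toReal_add hct hbt, hsplit]
  have hβ0 : 0 ≤ β := ENNReal.toReal_nonneg
  have hβle : β ≤ Real.exp (3 * κ + 2 - k) * N := by
    have h2 := ENNReal.toReal_mono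
      (ENNReal.mul_ne_top ENNReal.coe_ne_top ENNReal.ofReal_ne_top) hbadE
    rw [ENNReal.toReal_mul, ENNReal.coe_toReal, ENNReal.toReal_ofReal (Real.exp_pos _).le,
      hB] at h2
    calc β ≤ _ := h2
      _ ≤ Real.exp (2 * κ + 1 + 1) * (Real.exp κ * N) * Real.exp (-k) := by gcongr
      _ = Real.exp (2 * κ + 1 + 1) * Real.exp κ * Real.exp (-k) * N := by ring
      _ = _ := by rw [← Real.exp_add, ← Real.exp_add]; congr 2; ring
  -- The bad share is at most `δTV / 2 < 1 / 2`.
  have hcN2 : N / 2 ≤ c := by nlinarith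
  -- A lower bound for `c / B`, from `c ≥ N / 2` and `B ≤ exp (3κ + 2) N`.
  set b : ℝ := Real.exp (-(3 * κ + 2)) / 2 with hb
  have hb0 : 0 < b := by positivity
  have hb1 : b ≤ 1 := by
    have : Real.exp (-(3 * κ + 2)) ≤ 1 := Real.exp_le_one_iff.2 (by linarith)
    linarith
  have hrB : b * B ≤ c := by
    refine le_trans ?_ hcN2
    rw [hB]
    calc b * (Real.exp (2 * κ + 1 + 1) * V₀) ≤
          b * (Real.exp (2 * κ + 1 + 1) * (Real.exp κ * N)) := by gcongr
      _ = Real.exp (-(3 * κ + 2)) * Real.exp (2 * κ + 1 + 1) * Real.exp κ * N / 2 := by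
          rw [hb]; ring
      _ = N / 2 := by
          rw [← Real.exp_add, ← Real.exp_add,
            show -(3 * κ + 2) + (2 * κ + 1 + 1) + κ = 0 by ring, Real.exp_zero, one_mul]
  have key := tvDist_outputGiven_le (B := B) (r := ⟨b, hb0.le⟩) (s := ⟨1 - b, by linarith⟩)
    (c := c) (N := N) (τ := Real.exp (3 * κ + 2 - k)) hL hB0
    (NNReal.eq (add_sub_cancel b 1)) (by exact_mod_cast hb0) hE hG0 (ENNReal.ofReal_toReal hct).symm
    (ENNReal.ofReal_toReal hNt).symm hN0 hrB (by linarith) (by linarith)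
  refine key.trans ((add_le_add hHT hkT).trans (by linarith))

end ReasoningModel

end

/-- Constants depend only on `κ` (from `ε ≤ κ / T`) and `K` (from `δ ≤ K δTV`); the pool size and
the number of iterations depend on the problem only through `T`, `L`, `δ`, `δTV`. -/
theorem theorem6 :
    ∀ κ : ℝ, 0 < κ → ∀ K : ℝ, 0 < K →
    ∃ C : ℝ, 0 < C ∧ ∃ M H : ℕ → ℝ → ℝ → ℝ → ℕ+,
    ∀ (T : ℕ), 1 ≤ T → ∀ (L ε δ δTV : ℝ), 0 < L → 0 ≤ ε → ε ≤ κ / T →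
      0 < δ → δ < 1 → 0 < δTV → δTV < 1 → δ ≤ K * δTV →
    ∀ (S : ℕ → Type u) (m : ReasoningModel S) (s₀ : S 0) (hL : m.RatioBound s₀ T L),
      m.BellmanBound s₀ T ε →
      (m.resamplingMH s₀ T (M T L δ δTV) (H T L δ δTV)).RunsInTime
        (C * L * (T : ℝ) ^ 3 * Real.log (2 * T) * Real.log (2 / δ) * Real.log (2 / δTV)) ∧
      ∃ (E : Set (ReasoningModel.Run S (M T L δ δTV) T))
        (hE : ∃ r ∈ E, r ∈ (m.resamplingMH s₀ T (M T L δ δTV) (H T L δ δTV)).law.support),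
        ENNReal.ofReal (1 - δ) ≤
          (m.resamplingMH s₀ T (M T L δ δTV) (H T L δ δTV)).law.toOuterMeasure E ∧
        tvDist (m.outputGiven s₀ T (M T L δ δTV) (H T L δ δTV) E hE) (m.target s₀ T hL) ≤
          δTV := by
  intro κ hκ K hK
  set b : ℝ := 3 * κ + 2 with hb
  -- `h` and `q` absorb roundings and additive terms, using that both logarithms are at least `1 /
  -- 2`: `H ≤ h log (2 / δTV)` and `k ≤ q log (2 / δ)`.
  set h : ℝ := 2 * Real.exp b + 4 with hh
  set q : ℝ := (h + 1) * (1 + 2 * K) + 2 * b + 3 with hq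
  have hb0 : 0 < b := by positivity
  have hh0 : 0 < h := by positivity
  have hq0 : 0 < q := by positivity
  let H : ℝ → ℕ+ := fun δTV => (⌈2 * Real.exp b * Real.log (2 / δTV)⌉₊).succPNat
  -- The first two terms give `H exp (-k) ≤ δ` through the crude `H ≤ exp H`; the last makes the bad
  -- share at most `δTV / 2`.
  let k : ℝ → ℝ → ℕ := fun δ δTV =>
    ⌈(H δTV : ℕ) + Real.log (2 / δ) + (b + Real.log (2 / δTV))⌉₊
  refine ⟨120 * h * q, by positivity,
    fun T L δ δTV => (⌈k δ δTV * T * L⌉₊).succPNat, fun _ _ _ δTV => H δTV, ?_⟩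
  intro T hT L ε δ δTV _ hε hεT hδ hδ1 hTV hTV1 hδK S m s₀ hL hBell
  dsimp only
  have hL1 := hL.one_le hT
  have hT1 : (1 : ℝ) ≤ T := by exact_mod_cast hT
  have hlog2 : (1 / 2 : ℝ) ≤ Real.log 2 := by linarith [Real.log_two_gt_d9]
  set l : ℝ := Real.log (2 / δTV) with hl
  set d : ℝ := Real.log (2 / δ) with hd
  have hl2 : 1 / 2 ≤ l := hlog2.trans (Real.log_le_log two_pos ((le_div_iff₀ hTV).2 (by linarith)))
  have hd2 : 1 / 2 ≤ d := hlog2.trans (Real.log_le_log two_pos ((le_div_iff₀ hδ).2 (by linarith)))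
  -- Here `δ ≤ K δTV` enters: it makes `k` of order `log (2 / δ)` alone.
  have hld : l ≤ (1 + 2 * K) * d := by
    have h1 : l ≤ d + Real.log K := by
      rw [hl, hd, ← Real.log_mul (by positivity) hK.ne']
      refine Real.log_le_log (by positivity) ?_
      rw [div_mul_eq_mul_div, div_le_div_iff₀ hTV hδ]
      linarith
    have h2 := Real.log_le_sub_one_of_pos hK
    nlinarith
  set Hn : ℕ := (H δTV : ℕ) with hHn
  set kn : ℕ := k δ δTV with hkn
  have hHdef : (Hn : ℝ) = (⌈2 * Real.exp b * l⌉₊ : ℝ) + 1 := by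
    rw [hHn]; simp [H, hl]
  have hHlow : 2 * Real.exp b * l ≤ Hn := by
    rw [hHdef]
    linarith [Nat.le_ceil (2 * Real.exp b * l)]
  have hHup : (Hn : ℝ) ≤ h * l := by
    rw [hHdef, hh]
    have := Nat.ceil_lt_add_one (a := 2 * Real.exp b * l) (by positivity)
    nlinarith
  have hklow : Hn + d + (b + l) ≤ kn := Nat.le_ceil _
  have hkup : (kn : ℝ) ≤ q * d := by
    have h1 : (kn : ℝ) < Hn + d + (b + l) + 1 := Nat.ceil_lt_add_one (by positivity)
    have h2 : h * l ≤ h * ((1 + 2 * K) * d) := by gcongr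
    rw [hq]
    nlinarith
  have hkpos : 0 < kn := by
    have : (0 : ℝ) < kn := by
      have : (0 : ℝ) ≤ Hn := Nat.cast_nonneg _
      linarith
    exact_mod_cast this
  have hk1 : (1 : ℝ) ≤ kn := by exact_mod_cast hkpos
  have hHn0 : (0 : ℝ) ≤ Hn := Nat.cast_nonneg _
  set Mp : ℕ+ := (⌈kn * T * L⌉₊).succPNat with hMp
  have hMdef : ((Mp : ℕ) : ℝ) = (⌈kn * T * L⌉₊ : ℝ) + 1 := by
    rw [hMp]; simp
  have hMlow : kn * T * L ≤ (Mp : ℕ) := by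
    rw [hMdef]
    linarith [Nat.le_ceil (kn * T * L)]
  have hkTL : 1 ≤ kn * T * L := by
    have : 1 ≤ (kn : ℝ) * T := one_le_mul_of_one_le_of_one_le hk1 hT1
    exact one_le_mul_of_one_le_of_one_le this hL1
  have hMup : ((Mp : ℕ) : ℝ) ≤ 3 * (kn * T * L) := by
    rw [hMdef]
    have := Nat.ceil_lt_add_one (a := kn * T * L) (by positivity)
    linarith
  constructor
  · intro r hr
    have h1 : r.2 ≤ (Hn - 1 + 1) * (T * (5 * Mp + 4) + 11) :=
      m.costLE_mhLoop s₀ Mp T (Hn - 1) r hr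
    rw [Nat.sub_add_cancel (H δTV).pos] at h1
    have h2 : (r.2 : ℝ) ≤ Hn * (T * (5 * (Mp : ℕ) + 4) + 11) := by exact_mod_cast h1
    have hM1 : (1 : ℝ) ≤ (Mp : ℕ) := by exact_mod_cast Mp.pos
    have h3 : (T : ℝ) * (5 * (Mp : ℕ) + 4) + 11 ≤ 20 * (T * (Mp : ℕ)) := by nlinarith
    have hlogT : 1 / 2 ≤ Real.log (2 * T) :=
      hlog2.trans (Real.log_le_log two_pos (by linarith))
    calc (r.2 : ℝ) ≤ Hn * (20 * (T * (Mp : ℕ))) := h2.trans (by gcongr)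
      _ ≤ (h * l) * (20 * (T * (3 * ((q * d) * T * L)))) := by
          gcongr
          exact hMup.trans (by gcongr)
      -- The cost is quadratic in `T`; the remaining factor `T log (2T)` is slack, bounded below by
      -- `1 / 2`.
      _ = (120 * h * q * L * d * l * (T : ℝ) ^ 2) * (1 * (1 / 2)) := by ring
      _ ≤ (120 * h * q * L * d * l * (T : ℝ) ^ 2) * (T * Real.log (2 * T)) := by gcongr
      _ = _ := by ring
  · refine ReasoningModel.exists_event_tvDist_le (k := kn) hκ.le hT hε hεT hL hBell hMlow hkpos
      hδ1 hTV1 ?_ ?_ ?_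
    · calc (Hn : ℝ) * Real.exp (-kn) ≤ Real.exp Hn * Real.exp (-(Hn + d)) := by
            gcongr
            · linarith [Real.add_one_le_exp (Hn : ℝ)]
            · linarith
        _ = (2 / δ)⁻¹ := by
            rw [← Real.exp_add, show (Hn : ℝ) + -(Hn + d) = -d by ring, Real.exp_neg, hd,
              Real.exp_log (by positivity)]
        _ = δ / 2 := by rw [inv_div]
        _ ≤ δ := by linarith
    · have h1 : (0 : ℝ) ≤ 1 - Real.exp (-b) / 2 := by
        have : Real.exp (-b) ≤ 1 := Real.exp_le_one_iff.2 (by linarith)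
        linarith
      calc (1 - Real.exp (-b) / 2) ^ Hn ≤ Real.exp (-(Real.exp (-b) / 2)) ^ Hn := by
            gcongr
            linarith [Real.add_one_le_exp (-(Real.exp (-b) / 2))]
        _ = Real.exp (-(Hn * (Real.exp (-b) / 2))) := by
            rw [← Real.exp_nat_mul]; congr 1; ring
        _ ≤ Real.exp (-l) := by
            apply Real.exp_le_exp.2
            apply neg_le_neg
            calc l = 2 * Real.exp b * l * (Real.exp (-b) / 2) := by
                  rw [Real.exp_neg]
                  field_simp
              _ ≤ _ := by gcongr
        _ = δTV / 2 := by rw [Real.exp_neg, hl, Real.exp_log (by positivity), inv_div]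
    · calc Real.exp (b - kn) ≤ Real.exp (-l) := Real.exp_le_exp.2 (by linarith)
        _ = δTV / 2 := by rw [Real.exp_neg, hl, Real.exp_log (by positivity), inv_div]
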